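/- Let $n,d\ge 0$, let $\Delta\subseteq\mathbb C$ be the open unit disk and $\mathbb H$ the upper half plane. Let $\rho\colon\mathbb Z^n\to\mathrm{GL}_d(\mathbb Z)$ be a representation by unipotent matrices, let $T_j=\rho(\epsilon_j)$ be the image of the $j$-th standard generator $\epsilon_j$ of $\mathbb Z^n$, and let $N_j=-\log T_j=\sum_{m\ge1}\frac1m(\mathrm{id}-T_j)^m$. For $h\in\mathbb Z^d$ let $C(h)\subseteq\Delta^n\times\mathbb C^d$ be the image of $$\mathbb H^n\to\Delta^n\times\mathbb C^d,\qquad (z_1,\dots,z_n)\mapsto\bigl(e^{2\pi i z_1},\dots,e^{2\pi i z_n},\,e^{-(z_1N_1+\cdots+z_nN_n)}h\bigr),$$ and let $\overline{C(h)}$ be its closure in $\Delta^n\times\mathbb C^d$. Let $S=\{a\in\mathbb Z^n : \rho(a)h=h\}$, a free abelian group of rank $n-k$ for some $0\le k\le n$. (1) There is an integer $n\times n$ matrix $A=(a_{i,j})$ with $\det A=1$ whose last $n-k$ columns form a basis of $S$. (2) For every such $A$, put $M_j=\sum_{i}a_{i,j}N_i$. Then there are polynomials $p_1,\dots,p_k\in\mathbb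 C[v_1,\dots,v_d]$ inverting the exponential embedding, i.e. $p_s\bigl(e^{-(w_1M_1+\cdots+w_kM_k)}h\bigr)=w_s$ for all $w\in\mathbb C^k$ and $1\le s\le k$. There are also finitely many binomials $f_1,\dots,f_e\in\mathbb C[x_1,\dots,x_n]$, each a difference of two distinct monomials, whose set of common zeros in $\mathbb C^n$ is the topological closure of the image of the monomial map $$(\mathbb C^{*})^{n-k}\to\mathbb C^n,\qquad (u_{k+1},\dots,u_n)\mapsto\Bigl(\prod_{i=k+1}^n u_i^{a_{j,i}}\Bigr)_{j=1,\dots,n}.$$ (3) For every such $A$, all polynomials $p_1,\dots,p_k$ that invert the exponential embedding as in (2), and all polynomials $f_1,\dots,f_e$ (binomial or not) whose set of common zeros is the closure in (2), the set $\overline{C(h)}$ is exactly the set of those $(t,v)\in\Delta^n\times\mathbb C^d$ that satisfy the following $d+e$ equations, both sides of which are holomorphic on $\Delta^n\times\mathbb C^d$: $$v=e^{-(p_1(v)M_1+\cdots+p_k(v)M_k)}h$$ ($d$ equations, one for each component) and $$f_b\Bigl(t_1e^{-2\pi i\sum_{s\le k}a_{1,s}p_s(v)},\dots,t_ne^{-2\pi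 i\sum_{s\le k}a_{n,s}p_s(v)}\Bigr)=0,\qquad b=1,\dots,e.$$ (4) In particular $\overline{C(h)}$ is an analytic subset of $\Delta^n\times\mathbb C^d$. With its structure as an analytic subset (the local ring at a point is the ring of germs of holomorphic functions modulo the germs that vanish on $\overline{C(h)}$) it is reduced. It is irreducible: it is nonempty and is not the union of two analytic subsets of $\Delta^n\times\mathbb C^d$ that are both different from $\overline{C(h)}$. -/

import Mathlib

open scoped Topology Matrix

noncomputable section

namespace LocalSheet

/-! ### Analytic subsets of an open set, irreducibility, the reduced local rings -/

/-- `X` is a (closed) analytic subset of the open set `Ω`: near every point of `Ω` it is the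
common zero set of finitely many holomorphic functions. -/
def IsAnalyticSubset {E : Type*} [NormedAddCommGroup E] [NormedSpace ℂ E] (Ω X : Set E) : Prop :=
  X ⊆ Ω ∧ ∀ q ∈ Ω, ∃ U : Set E, IsOpen U ∧ q ∈ U ∧ U ⊆ Ω ∧
    ∃ (m : ℕ) (F : Fin m → E → ℂ), (∀ i, DifferentiableOn ℂ (F i) U) ∧
      X ∩ U = {x ∈ U | ∀ i, F i x = 0}

/-- An analytic subset `X` of `Ω` is irreducible: it is nonempty and is not the union of two
analytic subsets both different from `X`. -/
def IsIrreducibleAnalytic {E : Type*} [NormedAddCommGroup E] [NormedSpace ℂ E]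
    (Ω X : Set E) : Prop :=
  IsAnalyticSubset Ω X ∧ X.Nonempty ∧
    ∀ X₁ X₂ : Set E, IsAnalyticSubset Ω X₁ → IsAnalyticSubset Ω X₂ →
      X = X₁ ∪ X₂ → X₁ = X ∨ X₂ = X

/-- The ring of germs at `q` of holomorphic functions. -/
def holGerms {E : Type*} [NormedAddCommGroup E] [NormedSpace ℂ E] (q : E) :
    Subring (Filter.Germ (𝓝 q) ℂ) where
  carrier := {g | ∃ F : E → ℂ, AnalyticAt ℂ F q ∧ g = (F : Filter.Germ (𝓝 q) ℂ)}
  mul_mem' := by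
    rintro _ _ ⟨F, hF, rfl⟩ ⟨G, hG, rfl⟩
    exact ⟨F * G, hF.mul hG, rfl⟩
  one_mem' := ⟨fun _ => 1, analyticAt_const, rfl⟩
  add_mem' := by
    rintro _ _ ⟨F, hF, rfl⟩ ⟨G, hG, rfl⟩
    exact ⟨F + G, hF.add hG, rfl⟩
  zero_mem' := ⟨fun _ => 0, analyticAt_const, rfl⟩
  neg_mem' := by
    rintro _ ⟨F, hF, rfl⟩
    exact ⟨-F, hF.neg, rfl⟩

/-- The ideal of the holomorphic germs at `q` that vanish on `X` near `q`. -/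
def vanishingGerms {E : Type*} [NormedAddCommGroup E] [NormedSpace ℂ E] (X : Set E) (q : E) :
    Ideal (holGerms q) where
  carrier := {g | ∃ F : E → ℂ, (g : Filter.Germ (𝓝 q) ℂ) = (F : Filter.Germ (𝓝 q) ℂ) ∧
    ∀ᶠ x in 𝓝 q, x ∈ X → F x = 0}
  add_mem' := by
    rintro ⟨_, _⟩ ⟨_, _⟩ ⟨F, rfl, hF⟩ ⟨G, rfl, hG⟩
    refine ⟨F + G, rfl, ?_⟩
    filter_upwards [hF, hG] with x h1 h2 hx
    simp [h1 hx, h2 hx]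
  zero_mem' := ⟨fun _ => 0, rfl, Filter.Eventually.of_forall fun _ _ => rfl⟩
  smul_mem' := by
    rintro ⟨_, ⟨G, hG, rfl⟩⟩ ⟨_, _⟩ ⟨F, rfl, hF⟩
    refine ⟨G * F, rfl, ?_⟩
    filter_upwards [hF] with x h1 hx
    simp [h1 hx]

/-- The local ring at `q` of the analytic space carried by the analytic subset `X`, i.e. the
stalk of the sheaf of holomorphic functions modulo the ideal sheaf of `X`. -/
abbrev LocalRing {E : Type*} [NormedAddCommGroup E] [NormedSpace ℂ E] (X : Set E) (q : E) : Type _ :=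
  holGerms q ⧸ vanishingGerms X q

/-! ### The local system on the punctured polydisk and its sheets -/

/-- The set `Δⁿ × ℂᵈ`. -/
def bundle (n d : ℕ) : Set ((Fin n → ℂ) × (Fin d → ℂ)) := {q | ∀ j, ‖q.1 j‖ < 1}

/-- `ℤⁿ` acts on `ℤᵈ` by unipotent transformations. -/
def IsUnipotentRep {n d : ℕ} (ρ : Multiplicative (Fin n → ℤ) →* GL (Fin d) ℤ) : Prop :=
  ∀ a, IsNilpotent ((ρ a : Matrix (Fin d) (Fin d) ℤ) - 1)

/-- The matrix `T j` of the `j`-th standard generator, as a complex matrix. -/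
def monodromy {n d : ℕ} (ρ : Multiplicative (Fin n → ℤ) →* GL (Fin d) ℤ) (j : Fin n) :
    Matrix (Fin d) (Fin d) ℂ :=
  (ρ (Multiplicative.ofAdd (Pi.single j 1)) : Matrix (Fin d) (Fin d) ℤ).map (Int.cast : ℤ → ℂ)

/-- `N j = -log (T j) = ∑_{m ≥ 1} (1/m) (1 - T j)^m`. As `1 - T j` is a nilpotent `d × d` matrix,
the terms with `m > d` are zero. -/
def logMonodromy {n d : ℕ} (ρ : Multiplicative (Fin n → ℤ) →* GL (Fin d) ℤ) (j : Fin n) :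
    Matrix (Fin d) (Fin d) ℂ :=
  ∑ m ∈ Finset.Icc 1 d, (1 / (m : ℂ)) • (1 - monodromy ρ j) ^ m

/-- The vector `h ∈ ℤᵈ` as an element of `ℂᵈ`. -/
def toComplex {d : ℕ} (h : Fin d → ℤ) : Fin d → ℂ := fun i => (h i : ℂ)

/-- The map `f(z, h) = (e^{2πi z₁}, …, e^{2πi zₙ}, e^{-(z₁ N₁ + ⋯ + zₙ Nₙ)} h)`. -/
def param {n d : ℕ} (ρ : Multiplicative (Fin n → ℤ) →* GL (Fin d) ℤ) (h : Fin d → ℤ)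
    (z : Fin n → ℂ) : (Fin n → ℂ) × (Fin d → ℂ) :=
  (fun j => Complex.exp (2 * Real.pi * Complex.I * z j),
    NormedSpace.exp (-∑ j, z j • logMonodromy ρ j) *ᵥ toComplex h)

/-- The sheet `C(h)`, the image of `f(·, h)` on `ℍⁿ`. -/
def sheet {n d : ℕ} (ρ : Multiplicative (Fin n → ℤ) →* GL (Fin d) ℤ) (h : Fin d → ℤ) :
    Set ((Fin n → ℂ) × (Fin d → ℂ)) :=
  param ρ h '' {z | ∀ j, 0 < (z j).im}

/-- The closure of the sheet `C(h)` inside `Δⁿ × ℂᵈ`. -/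
def sheetClosure {n d : ℕ} (ρ : Multiplicative (Fin n → ℤ) →* GL (Fin d) ℤ) (h : Fin d → ℤ) :
    Set ((Fin n → ℂ) × (Fin d → ℂ)) :=
  closure (sheet ρ h) ∩ bundle n d

/-! ### Adapted coordinates -/

/-- The subgroup `S ⊆ ℤⁿ` of the elements that leave `h` invariant. -/
def invariance {n d : ℕ} (ρ : Multiplicative (Fin n → ℤ) →* GL (Fin d) ℤ) (h : Fin d → ℤ) :
    AddSubgroup (Fin n → ℤ) where
  carrier := {a | (ρ (Multiplicative.ofAdd a) : Matrix (Fin d) (Fin d) ℤ) *ᵥ h = h}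
  zero_mem' := by simp
  add_mem' := by
    intro a b ha hb
    simp only [Set.mem_ofPred_eq] at *
    rw [ofAdd_add, map_mul, Units.val_mul, ← Matrix.mulVec_mulVec, hb, ha]
  neg_mem' := by
    intro a ha
    simp only [Set.mem_ofPred_eq] at *
    rw [ofAdd_neg, map_inv]
    conv_lhs => rw [← ha]
    rw [Matrix.mulVec_mulVec, ← Units.val_mul, inv_mul_cancel, Units.val_one, Matrix.one_mulVec]

/-- `A` is an integer matrix of determinant `1` whose last `n - k` columns are a basis of the
subgroup `S` of the elements that leave `h` invariant. -/
structure IsAdapted {n d : ℕ} (ρ : Multiplicative (Fin n → ℤ) →* GL (Fin d) ℤ) (h : Fin d → ℤ)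
    (k : ℕ) (A : Matrix (Fin n) (Fin n) ℤ) : Prop where
  le : k ≤ n
  det_eq_one : A.det = 1
  linearIndependent :
    LinearIndependent ℤ (fun (j : {j : Fin n // k ≤ j.val}) (i : Fin n) => A i j.val)
  closure_eq : AddSubgroup.closure
    (Set.range fun (j : {j : Fin n // k ≤ j.val}) (i : Fin n) => A i j.val) = invariance ρ h

/-- `M s = ∑ i, a_{i,s} N i`. -/
def newLog {n d : ℕ} (ρ : Multiplicative (Fin n → ℤ) →* GL (Fin d) ℤ)
    (A : Matrix (Fin n) (Fin n) ℤ) (s : Fin n) : Matrix (Fin d) (Fin d) ℂ :=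
  ∑ i, (A i s : ℂ) • logMonodromy ρ i

/-- The exponential embedding `w ↦ e^{-(w₁ M₁ + ⋯ + w_k M_k)} h` of `ℂᵏ` into `ℂᵈ`. -/
def expEmbedding {n d : ℕ} (ρ : Multiplicative (Fin n → ℤ) →* GL (Fin d) ℤ) (h : Fin d → ℤ)
    {k : ℕ} (hk : k ≤ n) (A : Matrix (Fin n) (Fin n) ℤ) (w : Fin k → ℂ) : Fin d → ℂ :=
  NormedSpace.exp (-∑ s, w s • newLog ρ A (Fin.castLE hk s)) *ᵥ toComplex h

/-- The polynomials `p₁, …, p_k` in `v₁, …, v_d` invert the exponential embedding. -/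
def InvertsEmbedding {n d : ℕ} (ρ : Multiplicative (Fin n → ℤ) →* GL (Fin d) ℤ) (h : Fin d → ℤ)
    {k : ℕ} (hk : k ≤ n) (A : Matrix (Fin n) (Fin n) ℤ)
    (p : Fin k → MvPolynomial (Fin d) ℂ) : Prop :=
  ∀ (w : Fin k → ℂ) (s : Fin k), MvPolynomial.eval (expEmbedding ρ h hk A w) (p s) = w s

/-- The image of the monomial map `(ℂˣ)^{n-k} → ℂⁿ`, `x_j = ∏_{i > k} u_i ^ a_{j,i}`. -/
def monomialImage {n : ℕ} (k : ℕ) (A : Matrix (Fin n) (Fin n) ℤ) : Set (Fin n → ℂ) :=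
  Set.range fun (u : {i : Fin n // k ≤ i.val} → ℂˣ) (j : Fin n) => ∏ i, (u i : ℂ) ^ A j i.val

/-- The polynomials `f_b` define the closure of the image of the monomial map. -/
def DefinesMonomialClosure {n : ℕ} (k : ℕ) (A : Matrix (Fin n) (Fin n) ℤ) {e : ℕ}
    (f : Fin e → MvPolynomial (Fin n) ℂ) : Prop :=
  {x : Fin n → ℂ | ∀ b, MvPolynomial.eval x (f b) = 0} = closure (monomialImage k A)

/-- A difference `x^α - x^β` of two distinct monomials. -/
def IsBinomial {n : ℕ} (g : MvPolynomial (Fin n) ℂ) : Prop :=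
  ∃ α β : Fin n →₀ ℕ, α ≠ β ∧ g = MvPolynomial.monomial α 1 - MvPolynomial.monomial β 1

/-! ### The equations -/

/-- The `i`-th component of `v - e^{-(p₁(v) M₁ + ⋯ + p_k(v) M_k)} h`. -/
def equationA {n d : ℕ} (ρ : Multiplicative (Fin n → ℤ) →* GL (Fin d) ℤ) (h : Fin d → ℤ)
    {k : ℕ} (hk : k ≤ n) (A : Matrix (Fin n) (Fin n) ℤ) (p : Fin k → MvPolynomial (Fin d) ℂ)
    (i : Fin d) (q : (Fin n → ℂ) × (Fin d → ℂ)) : ℂ :=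
  q.2 i - expEmbedding ρ h hk A (fun s => MvPolynomial.eval q.2 (p s)) i

/-- `g(t₁ e^{-2πi ∑_{s ≤ k} a_{1,s} p_s(v)}, …, tₙ e^{-2πi ∑_{s ≤ k} a_{n,s} p_s(v)})`. -/
def equationB {n d : ℕ} {k : ℕ} (hk : k ≤ n) (A : Matrix (Fin n) (Fin n) ℤ)
    (p : Fin k → MvPolynomial (Fin d) ℂ) (g : MvPolynomial (Fin n) ℂ)
    (q : (Fin n → ℂ) × (Fin d → ℂ)) : ℂ :=
  MvPolynomial.eval (fun j => q.1 j * Complex.exp (-(2 * Real.pi * Complex.I *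
    ∑ s, (A j (Fin.castLE hk s) : ℂ) * MvPolynomial.eval q.2 (p s)))) g

end LocalSheet

end

/-!
In logarithmic coordinates the representation is `ρ a = exp (-∑ a j • N j)`, because the formal
identity `exp (log (1 - Y)) = 1 - Y` holds for nilpotent matrices (`exp_neg_log`). Since a nilpotent
`X` and `exp X - 1` have the same kernel, `a` fixes `h` if and only if `∑ a j • N j` kills `h`
(`mem_invariance_iff`). So the invariance group is saturated in `ℤⁿ`, and it is spanned by the last
columns of a unimodular matrix `A` (`exists_isAdapted`). In the coordinates `z = A w` the vector
`exp (-∑ z j • N j) h` depends only on `w₁, …, w_k`.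

As the logarithms are rational matrices, the vectors `M₁ h, …, M_k h` are linearly independent over
`ℂ`, not only over `ℤ`. An orbit map of commuting nilpotent matrices with this property has a
polynomial inverse (`exists_polynomial_inverse`): the parameter is recovered successively along the
filtration by the powers of the ideal generated by the matrices, where the orbit map restricted to
the parameters of one step is affine linear modulo the next step.

The closure of the image of a monomial map is cut out by the binomials that vanish on the image
(`zeroLocus_toricBinomials`). Given a common zero `x`, divisibility of `ℂˣ` provides a point of the
torus with the nonzero coordinates of `x` (`exists_torus_point`), and Gordan's theorem of the
alternative provides a one-parameter subgroup that moves the other coordinates to zero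
(`exists_rat_direction`). Finitely many binomials suffice by Hilbert's basis theorem.

The equations of the closure follow (`IsAdapted.sheetClosure_eq`): once `w₁, …, w_k` are read off
from `v`, the rest of the sheet is a translate of the monomial image, and taking closures affects
only that factor. Irreducibility holds because the sheet is the image of the connected set `ℍⁿ` under
a holomorphic map, and by the identity theorem an analytic subset that contains the image of a
nonempty open part of `ℍⁿ` contains the whole sheet.
-/

noncomputable section

namespace LocalSheet

/-! ### Exponentials and logarithms of nilpotent matrices -/

section Nilpotent

open Polynomial

theorem matrix_pow_card_eq_zero {d : ℕ} {X : Matrix (Fin d) (Fin d) ℂ} (hX : IsNilpotent X) :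
    X ^ d = 0 := by
  have h1 : IsNilpotent (Matrix.toLin' X) := hX.map (Matrix.toLinAlgEquiv' (R := ℂ) (n := Fin d))
  have h2 := h1.charpoly_eq_X_pow_finrank
  have h3 := LinearMap.aeval_self_charpoly (Matrix.toLin' X)
  rw [h2] at h3
  simp only [Module.finrank_fintype_fun_eq_card, Fintype.card_fin, map_pow, aeval_X] at h3
  have h4 : Matrix.toLin' (X ^ d) = 0 := by rw [Matrix.toLin'_pow, h3]
  exact (LinearEquiv.map_eq_zero_iff _).1 h4

theorem exp_eq_sum_of_pow_eq_zero {d N : ℕ} {X : Matrix (Fin d) (Fin d) ℂ} (hX : X ^ N = 0) :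
    NormedSpace.exp X = ∑ m ∈ Finset.range N, ((m.factorial : ℂ)⁻¹) • X ^ m := by
  rw [NormedSpace.exp_eq_tsum ℂ]
  refine tsum_eq_sum fun m hm => ?_
  rw [Finset.mem_range, not_lt] at hm
  rw [pow_eq_zero_of_le hm hX, smul_zero]

/-- The truncation of the formal identity `exp (-∑ Xᵐ / m) = 1 - X`. Writing `R` for the difference
of the truncated sides, `(1 - X) R' + R` is divisible by `X ^ d`, which determines the coefficients
of `R` recursively. -/
theorem X_pow_dvd_truncExp_comp_truncLog (d : ℕ) :
    (X : ℂ[X]) ^ (d + 1) ∣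
      (∑ m ∈ Finset.range (d + 1), C ((m.factorial : ℂ)⁻¹) * X ^ m).comp
        (-∑ m ∈ Finset.Icc 1 d, C (1 / (m : ℂ)) * X ^ m) - (1 - X) := by
  set E : ℂ[X] := ∑ m ∈ Finset.range (d + 1), C ((m.factorial : ℂ)⁻¹) * X ^ m with hE
  set P : ℂ[X] := ∑ m ∈ Finset.Icc 1 d, C (1 / (m : ℂ)) * X ^ m with hP
  have hE' : derivative E = E - C ((d.factorial : ℂ)⁻¹) * X ^ d := by
    rw [hE, derivative_sum, Finset.sum_range_succ', Finset.sum_range_succ _ d]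
    simp only [pow_zero, mul_one, derivative_C, add_zero, add_sub_cancel_right]
    refine Finset.sum_congr rfl fun m _ => ?_
    rw [derivative_C_mul, derivative_X_pow, ← mul_assoc, ← C_mul, Nat.add_sub_cancel]
    congr 2
    rw [Nat.factorial_succ]
    have h1 : (m.factorial : ℂ) ≠ 0 := by exact_mod_cast m.factorial_ne_zero
    have h2 : ((m + 1 : ℕ) : ℂ) ≠ 0 := by exact_mod_cast m.succ_ne_zero
    rw [Nat.cast_mul]
    field_simp
  have hP1 : P = ∑ m ∈ Finset.range d, C (1 / ((m + 1 : ℕ) : ℂ)) * X ^ (m + 1) := by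
    rw [hP, Finset.range_eq_Ico, Finset.sum_Ico_add' (fun m : ℕ => C (1 / (m : ℂ)) * X ^ m) 0 d 1]
    rfl
  have hP' : derivative P = ∑ m ∈ Finset.range d, X ^ m := by
    rw [hP1, derivative_sum]
    refine Finset.sum_congr rfl fun m _ => ?_
    rw [derivative_C_mul, derivative_X_pow, ← mul_assoc, ← C_mul, Nat.add_sub_cancel]
    have h2 : ((m + 1 : ℕ) : ℂ) ≠ 0 := by exact_mod_cast m.succ_ne_zero
    rw [one_div_mul_cancel h2, C_1, one_mul]
  have hXP : X ∣ P := by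
    rw [hP1]
    exact Finset.dvd_sum fun m _ => (dvd_pow_self _ m.succ_ne_zero).mul_left _
  have hgeom : (1 - X) * derivative P = 1 - X ^ d := by
    rw [hP', mul_comm]; exact geom_sum_mul_neg _ _
  set R : ℂ[X] := E.comp (-P) - (1 - X) with hR
  have hR' : (X : ℂ[X]) ^ d ∣ (1 - X) * derivative R + R := by
    have h1 : (1 - X) * derivative R + R = X ^ d * E.comp (-P)
        + C ((d.factorial : ℂ)⁻¹) * (-P) ^ d * (1 - X ^ d) := by
      have h2 : derivative R = -derivative P * (E.comp (-P) - C ((d.factorial : ℂ)⁻¹) * (-P) ^ d)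
          + 1 := by
        simp [hR, derivative_comp, hE']
      rw [h2, hR]
      linear_combination (-(E.comp (-P) - C ((d.factorial : ℂ)⁻¹) * (-P) ^ d)) * hgeom
    rw [h1]
    refine dvd_add (dvd_mul_right _ _) ((Dvd.dvd.mul_left ?_ _).mul_right _)
    exact pow_dvd_pow_of_dvd ((dvd_neg).2 hXP) d
  rw [X_pow_dvd_iff] at hR' ⊢
  intro m hm
  induction m with
  | zero =>
    obtain ⟨S, hS⟩ := hXP
    rw [coeff_zero_eq_eval_zero, hR, eval_sub, eval_comp, eval_neg, hS]
    simp [hE, eval_finsetSum, Finset.sum_range_succ']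
  | succ m ih =>
    have h1 := hR' m (by omega)
    have h0 := ih (by omega)
    have h2 : (m : ℂ) + 1 ≠ 0 := by exact_mod_cast m.succ_ne_zero
    have h3 : ((1 - X) * derivative R + R).coeff m = R.coeff (m + 1) * (m + 1) := by
      rw [sub_mul, one_mul, coeff_add, coeff_sub, coeff_derivative, h0]
      cases m with
      | zero => simp
      | succ m => rw [coeff_X_mul, coeff_derivative, h0]; simp
    rw [h3] at h1
    exact (mul_eq_zero.1 h1).resolve_right h2

theorem exp_neg_log {d : ℕ} {Y : Matrix (Fin d) (Fin d) ℂ} (hY : Y ^ d = 0) :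
    NormedSpace.exp (-∑ m ∈ Finset.Icc 1 d, (1 / (m : ℂ)) • Y ^ m) = 1 - Y := by
  obtain ⟨S, hS⟩ := X_pow_dvd_truncExp_comp_truncLog d
  have h1 : aeval Y (-∑ m ∈ Finset.Icc 1 d, C (1 / (m : ℂ)) * X ^ m : ℂ[X]) =
      -∑ m ∈ Finset.Icc 1 d, (1 / (m : ℂ)) • Y ^ m := by
    simp [map_sum, Algebra.smul_def]
  have h2 : (-∑ m ∈ Finset.Icc 1 d, (1 / (m : ℂ)) • Y ^ m) ^ (d + 1) = 0 := by
    refine pow_eq_zero_of_le d.le_succ (matrix_pow_card_eq_zero ?_)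
    refine (Commute.isNilpotent_sum (fun m hm => ?_) fun i j _ _ => ?_).neg
    · exact (IsNilpotent.pow_of_pos ⟨d, hY⟩ (by have := (Finset.mem_Icc.1 hm).1; omega)).smul _
    · exact (((Commute.refl Y).pow_pow _ _).smul_left _).smul_right _
  rw [exp_eq_sum_of_pow_eq_zero h2, ← h1]
  have h3 := congrArg (aeval Y) hS
  rw [map_sub, aeval_comp, map_mul, map_pow, aeval_X, pow_succ, hY, zero_mul, zero_mul,
    sub_eq_zero, h1] at h3
  rw [h1]
  simpa [map_sum, Algebra.smul_def] using h3

/-- For a nilpotent `X` the unipotent matrix `exp X` and `X` itself fix, respectively kill, the same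
vectors, because `exp X - 1` is `X` times an invertible matrix. -/
theorem exp_mulVec_eq_self_iff {d : ℕ} {X : Matrix (Fin d) (Fin d) ℂ} (hX : IsNilpotent X)
    (v : Fin d → ℂ) : NormedSpace.exp X *ᵥ v = v ↔ X *ᵥ v = 0 := by
  have h0 : X ^ (d + 2) = 0 := pow_eq_zero_of_le (by omega) (matrix_pow_card_eq_zero hX)
  set U : Matrix (Fin d) (Fin d) ℂ :=
    ∑ m ∈ Finset.range d, (((m + 2).factorial : ℂ)⁻¹) • X ^ m with hU
  have hXU : Commute X U :=
    Commute.sum_right _ _ _ fun m _ => ((Commute.refl X).pow_right _).smul_right _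
  have h1 : NormedSpace.exp X = 1 + (1 + X * U) * X := by
    rw [exp_eq_sum_of_pow_eq_zero h0, Finset.sum_range_succ', Finset.sum_range_succ', add_mul,
      hXU.eq, mul_assoc, hU, Finset.sum_mul]
    simp only [smul_mul_assoc, ← pow_two, ← pow_add, add_assoc]
    simp
    abel
  have h2 : IsUnit (1 + X * U) := (hXU.isNilpotent_mul_right hX).isUnit_one_add
  rw [h1, Matrix.add_mulVec, Matrix.one_mulVec, add_eq_left, ← Matrix.mulVec_mulVec]
  constructor
  · intro h
    have := Matrix.mulVec_injective_of_isUnit h2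
    exact this (by rw [h, Matrix.mulVec_zero])
  · intro h
    rw [h, Matrix.mulVec_zero]

end Nilpotent

/-! ### Polynomial functions -/

/-- The algebra of polynomial functions on `σ → ℂ`. -/
def polyFun (σ : Type*) : Subalgebra ℂ ((σ → ℂ) → ℂ) :=
  (MvPolynomial.aeval (fun (i : σ) (x : σ → ℂ) => x i)).range

theorem mem_polyFun {σ : Type*} {F : (σ → ℂ) → ℂ} :
    F ∈ polyFun σ ↔ ∃ p : MvPolynomial σ ℂ, ∀ x, MvPolynomial.eval x p = F x := by
  have key : ∀ (p : MvPolynomial σ ℂ) (x : σ → ℂ),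
      (MvPolynomial.aeval (fun (i : σ) (x : σ → ℂ) => x i) p : (σ → ℂ) → ℂ) x
        = MvPolynomial.eval x p := by
    intro p x
    induction p using MvPolynomial.induction_on with
    | C a => simp
    | add p q hp hq => simp [hp, hq]
    | mul_X p i hp => simp [hp]
  rw [polyFun, AlgHom.mem_range]
  exact exists_congr fun p => by simp only [funext_iff, key]

theorem coord_mem_polyFun {σ : Type*} (i : σ) : (fun x : σ → ℂ => x i) ∈ polyFun σ :=
  mem_polyFun.2 ⟨MvPolynomial.X i, by simp⟩

theorem eval_mem_polyFun {σ : Type*} (p : MvPolynomial σ ℂ) :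
    (fun x => MvPolynomial.eval x p) ∈ polyFun σ :=
  mem_polyFun.2 ⟨p, fun _ => rfl⟩

theorem const_mem_polyFun {σ : Type*} (c : ℂ) : (fun _ : σ → ℂ => c) ∈ polyFun σ :=
  mem_polyFun.2 ⟨MvPolynomial.C c, by simp⟩

theorem sum_mem_polyFun {σ ι : Type*} (s : Finset ι) {F : ι → (σ → ℂ) → ℂ}
    (hF : ∀ i ∈ s, F i ∈ polyFun σ) : (fun x => ∑ i ∈ s, F i x) ∈ polyFun σ := by
  have h := (polyFun σ).sum_mem hF
  convert h using 1
  ext x; simp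

theorem comp_mem_polyFun {σ τ : Type*} {F : (τ → ℂ) → ℂ} (hF : F ∈ polyFun τ)
    {G : (σ → ℂ) → τ → ℂ} (hG : ∀ t, (fun x => G x t) ∈ polyFun σ) :
    (fun x => F (G x)) ∈ polyFun σ := by
  obtain ⟨p, hp⟩ := mem_polyFun.1 hF
  simp only [← hp]
  clear hp hF
  induction p using MvPolynomial.induction_on with
  | C a => simpa using const_mem_polyFun a
  | add p q hp hq => simp only [map_add]; exact (polyFun σ).add_mem hp hq
  | mul_X p i hp =>
    simp only [map_mul, MvPolynomial.eval_X]; exact (polyFun σ).mul_mem hp (hG i)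

theorem mulVec_mem_polyFun {σ : Type*} {d : ℕ} {X : (σ → ℂ) → Matrix (Fin d) (Fin d) ℂ}
    {v : (σ → ℂ) → Fin d → ℂ} (hX : ∀ i j, (fun x => X x i j) ∈ polyFun σ)
    (hv : ∀ i, (fun x => v x i) ∈ polyFun σ) (i : Fin d) :
    (fun x => (X x *ᵥ v x) i) ∈ polyFun σ := by
  simp only [Matrix.mulVec, dotProduct]
  exact sum_mem_polyFun _ fun j _ => (polyFun σ).mul_mem (hX i j) (hv j)

/-- If the entries of the nilpotent matrix `X x` are polynomial functions of `x`, then so are those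
of `exp (X x)`, and `exp (X x)` maps polynomial vectors to polynomial vectors. -/
theorem exp_mulVec_mem_polyFun {σ : Type*} {d : ℕ} {X : (σ → ℂ) → Matrix (Fin d) (Fin d) ℂ}
    {v : (σ → ℂ) → Fin d → ℂ} (hX : ∀ i j, (fun x => X x i j) ∈ polyFun σ)
    (hnil : ∀ x, IsNilpotent (X x)) (hv : ∀ i, (fun x => v x i) ∈ polyFun σ) (i : Fin d) :
    (fun x => (NormedSpace.exp (X x) *ᵥ v x) i) ∈ polyFun σ := by
  have hpow : ∀ m i j, (fun x => (X x ^ m) i j) ∈ polyFun σ := by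
    intro m
    induction m with
    | zero => intro i j; simpa using const_mem_polyFun _
    | succ m ih =>
      intro i j
      simp only [pow_succ, Matrix.mul_apply]
      exact sum_mem_polyFun _ fun l _ => (polyFun σ).mul_mem (ih i l) (hX l j)
  refine mulVec_mem_polyFun (fun i j => ?_) hv i
  simp only [exp_eq_sum_of_pow_eq_zero (matrix_pow_card_eq_zero (hnil _)), Matrix.sum_apply,
    Matrix.smul_apply]
  exact sum_mem_polyFun _ fun m _ => (polyFun σ).smul_mem (hpow m i j) _

/-! ### Polynomial inverse of the exponential embedding -/

theorem commute_sum_smul {ι : Type*} [Fintype ι] {d : ℕ} {M : ι → Matrix (Fin d) (Fin d) ℂ}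
    (hcomm : ∀ s t, Commute (M s) (M t)) (w w' : ι → ℂ) :
    Commute (∑ s, w s • M s) (∑ s, w' s • M s) :=
  Commute.sum_right _ _ _ fun _ _ => Commute.sum_left _ _ _ fun _ _ =>
    ((hcomm _ _).smul_left _).smul_right _

theorem isNilpotent_sum_smul {ι : Type*} [Fintype ι] {d : ℕ} {M : ι → Matrix (Fin d) (Fin d) ℂ}
    (hcomm : ∀ s t, Commute (M s) (M t)) (hnil : ∀ s, IsNilpotent (M s)) (w : ι → ℂ) :
    IsNilpotent (∑ s, w s • M s) :=
  Commute.isNilpotent_sum (fun s _ => (hnil s).smul _) fun s t _ _ =>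
    ((hcomm s t).smul_left _).smul_right _

/-- Commuting nilpotent matrices strictly lower a finite filtration: if `𝔪` is the (nilpotent) ideal
that they generate in their commutative algebra, take the subspaces `𝔪 ^ i ℂᵈ`. -/
theorem exists_lowering_filtration {ι : Type*} [Finite ι] {d : ℕ}
    {M : ι → Matrix (Fin d) (Fin d) ℂ}
    (hcomm : ∀ s t, Commute (M s) (M t)) (hnil : ∀ s, IsNilpotent (M s)) :
    ∃ (W : ℕ → Submodule ℂ (Fin d → ℂ)) (c : ℕ), W 0 = ⊤ ∧ Antitone W ∧
      (∀ s i, ∀ x ∈ W i, M s *ᵥ x ∈ W (i + 1)) ∧ W c = ⊥ := by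
  have := Algebra.isMulCommutative_adjoin ℂ (s := Set.range M) (by
    rintro _ ⟨s, rfl⟩ _ ⟨t, rfl⟩
    exact hcomm s t)
  let _ : CommRing (Algebra.adjoin ℂ (Set.range M)) :=
    { (inferInstance : Ring (Algebra.adjoin ℂ (Set.range M))) with
      mul_comm := this.is_comm.comm }
  let g : ι → Algebra.adjoin ℂ (Set.range M) := fun s => ⟨M s, Algebra.subset_adjoin ⟨s, rfl⟩⟩
  let 𝔪 : Ideal (Algebra.adjoin ℂ (Set.range M)) := Ideal.span (Set.range g)
  have hfg : 𝔪.FG := Submodule.fg_span (Set.finite_range g)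
  have hle : 𝔪 ≤ nilradical (Algebra.adjoin ℂ (Set.range M)) := by
    rw [Ideal.span_le]
    rintro _ ⟨s, rfl⟩
    obtain ⟨N, hN⟩ := hnil s
    exact mem_nilradical.2 ⟨N, Subtype.ext hN⟩
  obtain ⟨c, hc⟩ := (Ideal.FG.isNilpotent_iff_le_nilradical hfg).2 hle
  refine ⟨fun i => Submodule.span ℂ
    {y | ∃ Y ∈ 𝔪 ^ i, ∃ v, y = (Y : Matrix (Fin d) (Fin d) ℂ) *ᵥ v}, c,
    ?_, ?_, ?_, ?_⟩
  · rw [eq_top_iff]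
    rintro v -
    exact Submodule.subset_span ⟨1, by simp, v, by simp⟩
  · intro i j hij
    refine Submodule.span_mono ?_
    rintro _ ⟨Y, hY, v, rfl⟩
    exact ⟨Y, Ideal.pow_le_pow_right hij hY, v, rfl⟩
  · intro s i x hx
    induction hx using Submodule.span_induction with
    | mem x hx =>
      obtain ⟨Y, hY, v, rfl⟩ := hx
      refine Submodule.subset_span ⟨g s * Y, ?_, v, ?_⟩
      · rw [pow_succ']
        exact Ideal.mul_mem_mul (Ideal.subset_span ⟨s, rfl⟩) hY
      · rw [Matrix.mulVec_mulVec]; rfl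
    | zero => simp
    | add x y _ _ hx hy => rw [Matrix.mulVec_add]; exact Submodule.add_mem _ hx hy
    | smul a x _ hx => rw [Matrix.mulVec_smul]; exact Submodule.smul_mem _ _ hx
  · refine Submodule.span_eq_bot.2 ?_
    rintro _ ⟨Y, hY, v, rfl⟩
    rw [hc, Submodule.zero_eq_bot, Submodule.mem_bot] at hY
    rw [hY]; simp

/-- If `X` lowers the filtration `W` and `X v` lies in its `i`-th step, then `exp X v = v + X v` up
to the step `i + 1`. -/
theorem exp_mulVec_sub_mem {d : ℕ} {X : Matrix (Fin d) (Fin d) ℂ} (hX : IsNilpotent X)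
    {W : ℕ → Submodule ℂ (Fin d → ℂ)} (hanti : Antitone W)
    (hW : ∀ i, ∀ x ∈ W i, X *ᵥ x ∈ W (i + 1)) {i : ℕ} {v : Fin d → ℂ} (hv : X *ᵥ v ∈ W i) :
    NormedSpace.exp X *ᵥ v - v - X *ᵥ v ∈ W (i + 1) := by
  have h0 : X ^ (d + 2) = 0 := pow_eq_zero_of_le (by omega) (matrix_pow_card_eq_zero hX)
  have hpow : ∀ m, X ^ (m + 1) *ᵥ v ∈ W (i + m) := by
    intro m
    induction m with
    | zero => simpa using hv
    | succ m ih =>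
      rw [pow_succ', ← Matrix.mulVec_mulVec]
      exact hW _ _ ih
  have h1 : NormedSpace.exp X *ᵥ v - v - X *ᵥ v =
      ∑ m ∈ Finset.range d, ((m + 1 + 1).factorial : ℂ)⁻¹ • X ^ (m + 1 + 1) *ᵥ v := by
    rw [exp_eq_sum_of_pow_eq_zero h0, Finset.sum_range_succ', Finset.sum_range_succ',
      Matrix.add_mulVec, Matrix.add_mulVec, Matrix.sum_mulVec]
    simp [Matrix.smul_mulVec]
  rw [h1]
  exact Submodule.sum_mem _ fun m _ => Submodule.smul_mem _ _ (hanti (by omega) (hpow (m + 1)))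

theorem exists_pseudoInverse {K E Q : Type*} [Field K] [AddCommGroup E] [Module K E]
    [AddCommGroup Q] [Module K Q] (τ : E →ₗ[K] Q) :
    ∃ σ : Q →ₗ[K] E, ∀ x, τ (σ (τ x)) = τ x := by
  obtain ⟨r, hr⟩ := τ.rangeRestrict.exists_rightInverse_of_surjective
    (LinearMap.range_eq_top.2 τ.surjective_rangeRestrict)
  obtain ⟨σ, hσ⟩ := LinearMap.exists_extend r
  refine ⟨σ, fun x => ?_⟩
  have h1 : σ (τ x) = r (τ.rangeRestrict x) := LinearMap.congr_fun hσ (τ.rangeRestrict x)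
  rw [h1]
  exact congrArg Subtype.val (LinearMap.congr_fun hr (τ.rangeRestrict x))

/-- A linearly nondegenerate orbit map `w ↦ exp (-∑ w s • M s) h` of commuting nilpotent matrices
has a polynomial inverse. One recovers `w` step by step along the filtration: once `w` is known up
to an error `w'` with `(∑ w' s • M s) h ∈ W i`, moving the orbit point back by the known part leaves
`exp (-∑ w' s • M s) h`, which is affine linear in `w'` modulo `W (i + 1)`. -/
theorem exists_polynomial_inverse {k d : ℕ} {M : Fin k → Matrix (Fin d) (Fin d) ℂ}
    (hcomm : ∀ s t, Commute (M s) (M t)) (hnil : ∀ s, IsNilpotent (M s)) (h : Fin d → ℂ)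
    (hinj : ∀ w : Fin k → ℂ, (∑ s, w s • M s) *ᵥ h = 0 → w = 0) :
    ∃ p : Fin k → MvPolynomial (Fin d) ℂ, ∀ (w : Fin k → ℂ) s,
      MvPolynomial.eval (NormedSpace.exp (-∑ s, w s • M s) *ᵥ h) (p s) = w s := by
  obtain ⟨W, c, hW0, hanti, hW, hWc⟩ := exists_lowering_filtration hcomm hnil
  have hWsum : ∀ (w : Fin k → ℂ) i, ∀ x ∈ W i, (∑ s, w s • M s) *ᵥ x ∈ W (i + 1) := by
    intro w i x hx
    rw [Matrix.sum_mulVec]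
    refine Submodule.sum_mem _ fun s _ => ?_
    rw [Matrix.smul_mulVec]
    exact Submodule.smul_mem _ _ (hW s i x hx)
  let Λ : (Fin k → ℂ) →ₗ[ℂ] (Fin d → ℂ) :=
    { toFun := fun w => (∑ s, w s • M s) *ᵥ h
      map_add' := fun w w' => by
        rw [← Matrix.add_mulVec, ← Finset.sum_add_distrib]; simp [add_smul]
      map_smul' := fun a w => by
        rw [RingHom.id_apply, ← Matrix.smul_mulVec, Finset.smul_sum]; simp [smul_smul] }
  have key : ∀ i, ∃ F : (Fin d → ℂ) → Fin k → ℂ, (∀ s, (fun v => F v s) ∈ polyFun (Fin d)) ∧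
      ∀ w, Λ (w - F (NormedSpace.exp (-∑ s, w s • M s) *ᵥ h)) ∈ W (i + 1) := by
    intro i
    induction i with
    | zero =>
      exact ⟨fun _ _ => 0, fun s => const_mem_polyFun 0, fun w =>
        hWsum _ 0 h (by rw [hW0]; trivial)⟩
    | succ i ih =>
      obtain ⟨F, hF, hFW⟩ := ih
      obtain ⟨σ, hσ⟩ := exists_pseudoInverse ((W (i + 2)).mkQ ∘ₗ Λ)
      let G : (Fin d → ℂ) →ₗ[ℂ] (Fin k → ℂ) := σ ∘ₗ (W (i + 2)).mkQ
      let B : (Fin d → ℂ) → Fin d → ℂ := fun v => NormedSpace.exp (∑ s, F v s • M s) *ᵥ v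
      have hB : ∀ j, (fun v => B v j) ∈ polyFun (Fin d) := by
        refine exp_mulVec_mem_polyFun (fun a b => ?_) (fun v => isNilpotent_sum_smul hcomm hnil _)
          coord_mem_polyFun
        simp only [Matrix.sum_apply, Matrix.smul_apply]
        exact sum_mem_polyFun _ fun s _ => (polyFun _).mul_mem (hF s) (const_mem_polyFun _)
      refine ⟨fun v => F v + G (h - B v), fun s => ?_, fun w => ?_⟩
      · have h1 : ∀ v, (F v + G (h - B v)) s =
            F v s + ∑ j, LinearMap.toMatrix' G s j * (h j - B v j) := by
          intro v
          rw [Pi.add_apply, ← LinearMap.toMatrix'_mulVec G]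
          rfl
        simp only [h1]
        exact (polyFun _).add_mem (hF s) (sum_mem_polyFun _ fun j _ => (polyFun _).mul_mem
          (const_mem_polyFun _) ((polyFun _).sub_mem (const_mem_polyFun _) (hB j)))
      · set v := NormedSpace.exp (-∑ s, w s • M s) *ᵥ h with hv
        have h1 : B v = NormedSpace.exp (-∑ s, (w - F v) s • M s) *ᵥ h := by
          have h2 : -∑ s, (w - F v) s • M s = ∑ s, F v s • M s + -∑ s, w s • M s := by
            simp only [Pi.sub_apply, sub_smul, Finset.sum_sub_distrib]
            abel
          rw [h2, Matrix.exp_add_of_commute _ _ (commute_sum_smul hcomm _ _).neg_right,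
            ← Matrix.mulVec_mulVec]
        have h3 := exp_mulVec_sub_mem (X := -∑ s, (w - F v) s • M s) (v := h) (i := i + 1)
          (isNilpotent_sum_smul hcomm hnil _).neg hanti
          (fun j x hx => by
            rw [Matrix.neg_mulVec]; exact Submodule.neg_mem _ (hWsum _ j x hx))
          (by rw [Matrix.neg_mulVec]; exact Submodule.neg_mem _ (hFW w))
        rw [← h1, Matrix.neg_mulVec] at h3
        have h4 : (W (i + 2)).mkQ (h - B v) = (W (i + 2)).mkQ (Λ (w - F v)) := by
          rw [← sub_eq_zero, ← map_sub, Submodule.mkQ_apply, Submodule.Quotient.mk_eq_zero]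
          have := Submodule.neg_mem _ h3
          convert this using 1
          change h - B v - (∑ s, (w - F v) s • M s) *ᵥ h = _
          abel
        have h5 : w - (F v + G (h - B v)) =
            (w - F v) - σ (((W (i + 2)).mkQ ∘ₗ Λ) (w - F v)) := by
          rw [sub_add_eq_sub_sub]
          congr 1
          exact congrArg σ h4
        have h6 : ((W (i + 2)).mkQ ∘ₗ Λ) (w - (F v + G (h - B v))) = 0 := by
          rw [h5, map_sub, hσ, sub_self]
        rwa [LinearMap.comp_apply, Submodule.mkQ_apply, Submodule.Quotient.mk_eq_zero] at h6
  -- The filtration ends at zero, so the last approximation of `w` is exact.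
  obtain ⟨F, hF, hFW⟩ := key c
  choose p hp using fun s => mem_polyFun.1 (hF s)
  refine ⟨p, fun w s => ?_⟩
  have h1 := hanti c.le_succ (hFW w)
  rw [hWc, Submodule.mem_bot] at h1
  have h2 := hinj _ h1
  rw [hp, ← sub_eq_zero.1 h2]

/-! ### The representation in terms of the logarithms -/

section Representation

variable {n d : ℕ} {ρ : Multiplicative (Fin n → ℤ) →* GL (Fin d) ℤ}

theorem isNilpotent_one_sub_monodromy (hρ : IsUnipotentRep ρ) (j : Fin n) :
    IsNilpotent (1 - monodromy ρ j) := by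
  have h1 := (hρ (Multiplicative.ofAdd (Pi.single j 1))).neg.map
    (Int.castRingHom ℂ).mapMatrix
  rwa [neg_sub, map_sub, map_one] at h1

theorem commute_logMonodromy (ρ : Multiplicative (Fin n → ℤ) →* GL (Fin d) ℤ) (i j : Fin n) :
    Commute (logMonodromy ρ i) (logMonodromy ρ j) := by
  have h1 : Commute (monodromy ρ i) (monodromy ρ j) := by
    have h2 := (((Commute.all (Multiplicative.ofAdd (Pi.single i (1 : ℤ)))
      (Multiplicative.ofAdd (Pi.single j 1))).map ρ).map (Units.coeHom _)).map
        (Int.castRingHom ℂ).mapMatrix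
    exact h2
  refine Commute.sum_right _ _ _ fun m _ => Commute.sum_left _ _ _ fun m' _ => ?_
  refine Commute.smul_right (Commute.smul_left (Commute.pow_pow ?_ _ _) _) _
  exact ((Commute.one_right _).sub_right ((Commute.one_left _).sub_left h1))

theorem isNilpotent_logMonodromy (hρ : IsUnipotentRep ρ) (j : Fin n) :
    IsNilpotent (logMonodromy ρ j) := by
  refine Commute.isNilpotent_sum (fun m hm => ?_) fun i j _ _ => ?_
  · exact ((isNilpotent_one_sub_monodromy hρ j).pow_of_pos
      (by have := (Finset.mem_Icc.1 hm).1; omega)).smul _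
  · exact (((Commute.refl _).pow_pow _ _).smul_left _).smul_right _

theorem exp_neg_logMonodromy (hρ : IsUnipotentRep ρ) (j : Fin n) :
    NormedSpace.exp (-logMonodromy ρ j) = monodromy ρ j := by
  rw [logMonodromy, exp_neg_log (matrix_pow_card_eq_zero (isNilpotent_one_sub_monodromy hρ j)),
    sub_sub_cancel]

theorem exp_neg_sum_logMonodromy (hρ : IsUnipotentRep ρ) (a : Fin n → ℤ) :
    NormedSpace.exp (-∑ j, (a j : ℂ) • logMonodromy ρ j) =
      (ρ (Multiplicative.ofAdd a) : Matrix (Fin d) (Fin d) ℤ).map (Int.cast : ℤ → ℂ) := by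
  let R : Multiplicative (Fin n → ℤ) →* Matrix (Fin d) (Fin d) ℂ :=
    ((Int.castRingHom ℂ).mapMatrix : Matrix (Fin d) (Fin d) ℤ →+* _).toMonoidHom.comp
      ((Units.coeHom _).comp ρ)
  let E : (Fin n → ℤ) → Matrix (Fin d) (Fin d) ℂ := fun a =>
    NormedSpace.exp (-∑ j, (a j : ℂ) • logMonodromy ρ j)
  have hE0 : E 0 = 1 := by simp [E]
  have hEadd : ∀ a b, E (a + b) = E a * E b := by
    intro a b
    have h1 : -∑ j, ((a + b) j : ℂ) • logMonodromy ρ j =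
        -∑ j, (a j : ℂ) • logMonodromy ρ j + -∑ j, (b j : ℂ) • logMonodromy ρ j := by
      simp only [Pi.add_apply, Int.cast_add, add_smul, Finset.sum_add_distrib, neg_add]
    change NormedSpace.exp _ = _
    rw [h1, Matrix.exp_add_of_commute]
    exact (commute_sum_smul (commute_logMonodromy ρ) _ _).neg_left.neg_right
  -- Both sides are homomorphisms, so they agree on a subgroup; it contains the generators.
  let H : AddSubgroup (Fin n → ℤ) :=
    { carrier := {a | E a = R (Multiplicative.ofAdd a)}
      zero_mem' := by simpa using hE0
      add_mem' := by
        intro a b (ha : E a = _) (hb : E b = _)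
        change E _ = _
        rw [hEadd, ha, hb, ofAdd_add, map_mul]
      neg_mem' := by
        intro a (ha : E a = _)
        change E _ = _
        have h1 : R (Multiplicative.ofAdd a) * R (Multiplicative.ofAdd (-a)) = 1 := by
          rw [← map_mul, ← ofAdd_add, add_neg_cancel, ofAdd_zero, map_one]
        have h2 : E (-a) * E a = 1 := by rw [← hEadd, neg_add_cancel, hE0]
        rw [← mul_one (E (-a)), ← h1, ← ha, ← mul_assoc, h2, one_mul] }
  have hsingle : ∀ j, Pi.single j 1 ∈ H := by
    intro j
    change E _ = _
    have h1 : ∑ i, ((Pi.single j (1 : ℤ) : Fin n → ℤ) i : ℂ) • logMonodromy ρ i =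
        logMonodromy ρ j := by
      rw [Finset.sum_eq_single j]
      · simp
      · intro b _ hb; simp [Pi.single_eq_of_ne hb]
      · simp
    change NormedSpace.exp _ = _
    rw [h1, exp_neg_logMonodromy hρ]
    rfl
  have hmem : a ∈ H := by
    rw [← Finset.univ_sum_single a]
    refine H.sum_mem fun j _ => ?_
    have h1 : (Pi.single j (a j) : Fin n → ℤ) = a j • Pi.single j 1 := by
      rw [← Pi.single_smul]; simp
    rw [h1]
    exact H.zsmul_mem (hsingle j) _
  exact hmem

theorem mem_invariance_iff (hρ : IsUnipotentRep ρ) (h : Fin d → ℤ) (a : Fin n → ℤ) :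
    a ∈ invariance ρ h ↔ (∑ j, (a j : ℂ) • logMonodromy ρ j) *ᵥ toComplex h = 0 := by
  have hnil := isNilpotent_sum_smul (commute_logMonodromy ρ) (isNilpotent_logMonodromy hρ)
    (fun j => (a j : ℂ))
  rw [← neg_eq_zero, ← Matrix.neg_mulVec, ← exp_mulVec_eq_self_iff hnil.neg,
    exp_neg_sum_logMonodromy hρ]
  change (ρ (Multiplicative.ofAdd a) : Matrix (Fin d) (Fin d) ℤ) *ᵥ h = h ↔ _
  have h1 : ∀ i, (((ρ (Multiplicative.ofAdd a) : Matrix (Fin d) (Fin d) ℤ).map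
      (Int.cast : ℤ → ℂ)) *ᵥ toComplex h) i =
      (((ρ (Multiplicative.ofAdd a) : Matrix (Fin d) (Fin d) ℤ) *ᵥ h) i : ℂ) := by
    intro i
    simp [Matrix.mulVec, dotProduct, toComplex]
  rw [funext_iff, funext_iff]
  refine forall_congr' fun i => ?_
  rw [h1]
  simp [toComplex]

theorem mem_invariance_of_zsmul_mem (hρ : IsUnipotentRep ρ) (h : Fin d → ℤ) {m : ℤ} (hm : m ≠ 0)
    {a : Fin n → ℤ} (ha : m • a ∈ invariance ρ h) : a ∈ invariance ρ h := by
  rw [mem_invariance_iff hρ] at ha ⊢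
  have h1 : ∑ j, ((m • a) j : ℂ) • logMonodromy ρ j =
      (m : ℂ) • ∑ j, (a j : ℂ) • logMonodromy ρ j := by
    rw [Finset.smul_sum]; simp [smul_smul]
  rw [h1, Matrix.smul_mulVec] at ha
  exact (smul_eq_zero.1 ha).resolve_left (by exact_mod_cast hm)

theorem exists_rat_logMonodromy_mulVec (ρ : Multiplicative (Fin n → ℤ) →* GL (Fin d) ℤ)
    (h : Fin d → ℤ) : ∃ x : Fin n → Fin d → ℚ,
      ∀ j i, (logMonodromy ρ j *ᵥ toComplex h) i = (x j i : ℂ) := by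
  let T : Fin n → Matrix (Fin d) (Fin d) ℚ := fun j =>
    (Int.castRingHom ℚ).mapMatrix
      (ρ (Multiplicative.ofAdd (Pi.single j 1)) : Matrix (Fin d) (Fin d) ℤ)
  let N : Fin n → Matrix (Fin d) (Fin d) ℚ := fun j =>
    ∑ m ∈ Finset.Icc 1 d, (1 / (m : ℚ)) • (1 - T j) ^ m
  have hN : ∀ j, logMonodromy ρ j = (algebraMap ℚ ℂ).mapMatrix (N j) := by
    intro j
    have hT : (algebraMap ℚ ℂ).mapMatrix (T j) = monodromy ρ j := by
      ext a b; simp [T, monodromy]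
    rw [map_sum, logMonodromy]
    refine Finset.sum_congr rfl fun m _ => ?_
    have h1 : (algebraMap ℚ ℂ).mapMatrix ((1 / (m : ℚ)) • (1 - T j) ^ m) =
        (1 / (m : ℂ)) • (algebraMap ℚ ℂ).mapMatrix ((1 - T j) ^ m) := by
      ext a b; simp
    rw [h1, map_pow, map_sub, map_one, hT]
  refine ⟨fun j => N j *ᵥ fun i => (h i : ℚ), fun j i => ?_⟩
  rw [hN]
  simp [Matrix.mulVec, dotProduct, toComplex]

end Representation

/-! ### Adapted coordinates -/

theorem exists_int_multiple {ι : Type*} [Finite ι] (q : ι → ℚ) :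
    ∃ (D : ℕ) (b : ι → ℤ), D ≠ 0 ∧ ∀ i, (b i : ℚ) = D * q i := by
  have := Fintype.ofFinite ι
  refine ⟨∏ i, (q i).den, fun i => (q i).num * ((∏ i, (q i).den) / (q i).den : ℕ),
    Finset.prod_ne_zero_iff.2 fun i _ => (q i).den_nz, fun i => ?_⟩
  have hd : (q i).den ∣ ∏ i, (q i).den := Finset.dvd_prod_of_mem _ (Finset.mem_univ i)
  have h0 : ((q i).den : ℚ) ≠ 0 := by exact_mod_cast (q i).den_nz
  conv_rhs => rw [← Rat.num_div_den (q i)]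
  rw [Int.cast_mul, Int.cast_natCast, Nat.cast_div hd h0]
  field_simp

/-- The vector with the entries of `w` in the first `k` places and those of `u` in the others. -/
def glue {α : Type*} {n k : ℕ} (w : Fin k → α) (u : {j : Fin n // k ≤ j.val} → α) (j : Fin n) : α :=
  if hj : k ≤ j.val then u ⟨j, hj⟩ else w ⟨j.val, not_le.1 hj⟩

theorem glue_castLE {α : Type*} {n k : ℕ} (hk : k ≤ n) (w : Fin k → α)
    (u : {j : Fin n // k ≤ j.val} → α) (s : Fin k) : glue w u (Fin.castLE hk s) = w s := by
  simp [glue]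

theorem glue_val {α : Type*} {n k : ℕ} (w : Fin k → α)
    (u : {j : Fin n // k ≤ j.val} → α) (j : {j : Fin n // k ≤ j.val}) : glue w u j.val = u j := by
  simp [glue, j.2]

theorem sum_eq_sum_castLE_add {β : Type*} [AddCommMonoid β] {n k : ℕ} (hk : k ≤ n)
    (F : Fin n → β) :
    ∑ j, F j = ∑ s : Fin k, F (Fin.castLE hk s) + ∑ j : {j : Fin n // k ≤ j.val}, F j.val := by
  rw [← Fintype.sum_subtype_add_sum_subtype (fun j : Fin n => k ≤ j.val) F, add_comm]
  congr 1
  let e : Fin k ≃ {j : Fin n // ¬ k ≤ j.val} :=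
    { toFun := fun s => ⟨Fin.castLE hk s, by simp⟩
      invFun := fun j => ⟨j.val.val, not_le.1 j.2⟩
      left_inv := fun s => by simp
      right_inv := fun j => by simp }
  exact (Fintype.sum_equiv e _ _ fun s => rfl).symm

section Adapted

variable {n d : ℕ} {ρ : Multiplicative (Fin n → ℤ) →* GL (Fin d) ℤ} {h : Fin d → ℤ} {k : ℕ}
  {A : Matrix (Fin n) (Fin n) ℤ}

theorem IsAdapted.newLog_mulVec_eq_zero (hρ : IsUnipotentRep ρ) (hA : IsAdapted ρ h k A)
    (j : {j : Fin n // k ≤ j.val}) : newLog ρ A j.val *ᵥ toComplex h = 0 := by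
  refine (mem_invariance_iff hρ h fun i => A i j.val).1 ?_
  rw [← hA.closure_eq]
  exact AddSubgroup.subset_closure ⟨j, rfl⟩

/-- An integral combination of the first `k` columns that fixes `h` is trivial, as the first `k`
columns are independent modulo the others. -/
theorem IsAdapted.eq_zero_of_mem_invariance (hA : IsAdapted ρ h k A) (b : Fin k → ℤ)
    (hb : (fun i => ∑ s, b s * A i (Fin.castLE hA.le s)) ∈ invariance ρ h) : b = 0 := by
  rw [← hA.closure_eq, ← Submodule.span_int_eq_addSubgroupClosure,
    Submodule.mem_toAddSubgroup, Submodule.mem_span_range_iff_exists_fun] at hb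
  obtain ⟨c, hc⟩ := hb
  have h1 : A *ᵥ glue b (-c) = 0 := by
    ext i
    have h2 := congrFun hc i
    simp only [Finset.sum_apply, Pi.smul_apply, smul_eq_mul] at h2
    rw [Matrix.mulVec, dotProduct, sum_eq_sum_castLE_add hA.le]
    simp only [glue_castLE, glue_val, Pi.neg_apply, mul_neg, Finset.sum_neg_distrib, Pi.zero_apply]
    rw [add_neg_eq_zero]
    simp only [mul_comm (A _ _)]
    exact h2.symm
  have h2 : glue b (-c) = 0 :=
    Matrix.eq_zero_of_mulVec_eq_zero (by rw [hA.det_eq_one]; exact one_ne_zero) h1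
  ext s
  rw [← glue_castLE hA.le b (-c) s, h2]
  rfl

/-- The linear map `w ↦ (w₁ M₁ + ⋯ + w_k M_k) h` is injective. It is defined over `ℚ`, so applying
`ℚ`-linear functionals `ℂ → ℚ` to a relation and clearing denominators leads to an integral relation,
that is, to an element of the invariance group. -/
theorem IsAdapted.eq_zero_of_sum_newLog_mulVec (hρ : IsUnipotentRep ρ) (hA : IsAdapted ρ h k A)
    (w : Fin k → ℂ)
    (hw : (∑ s, w s • newLog ρ A (Fin.castLE hA.le s)) *ᵥ toComplex h = 0) : w = 0 := by
  obtain ⟨x, hx⟩ := exists_rat_logMonodromy_mulVec ρ h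
  let y : Fin k → Fin d → ℚ := fun s l => ∑ i, (A i (Fin.castLE hA.le s) : ℚ) * x i l
  have hy : ∀ s l, (newLog ρ A (Fin.castLE hA.le s) *ᵥ toComplex h) l = (y s l : ℂ) := by
    intro s l
    rw [newLog, Matrix.sum_mulVec, Finset.sum_apply]
    simp [y, Matrix.smul_mulVec, hx]
  have hw' : ∀ l, ∑ s, w s * (y s l : ℂ) = 0 := by
    intro l
    rw [Matrix.sum_mulVec] at hw
    have := congrFun hw l
    simpa [Matrix.smul_mulVec, hy] using this
  ext s
  refine (Module.forall_dual_apply_eq_zero_iff ℚ (w s)).1 fun f => ?_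
  have hf : ∀ l, ∑ s, f (w s) * y s l = 0 := by
    intro l
    have h1 := congrArg f (hw' l)
    rw [map_sum, map_zero] at h1
    rw [← h1]
    refine Finset.sum_congr rfl fun s _ => ?_
    have h2 : w s * (y s l : ℂ) = y s l • w s := by rw [Rat.smul_def, mul_comm]
    rw [h2, map_smul, smul_eq_mul, mul_comm]
  obtain ⟨D, b, hD, hb⟩ := exists_int_multiple fun s => f (w s)
  have hD' : (D : ℚ) ≠ 0 := by exact_mod_cast hD
  have h1 : b = 0 := by
    refine hA.eq_zero_of_mem_invariance b ((mem_invariance_iff hρ h _).2 ?_)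
    ext l
    rw [Matrix.sum_mulVec, Finset.sum_apply]
    simp only [Matrix.smul_mulVec, Pi.smul_apply, hx, smul_eq_mul, Pi.zero_apply]
    have h2 : ∑ j, ((∑ s, b s * A j (Fin.castLE hA.le s) : ℤ) : ℚ) * x j l = 0 := by
      push_cast
      simp only [hb, Finset.sum_mul]
      rw [Finset.sum_comm]
      calc _ = D * ∑ s, f (w s) * y s l := by
            rw [Finset.mul_sum]
            refine Finset.sum_congr rfl fun s _ => ?_
            simp only [y, Finset.mul_sum]
            exact Finset.sum_congr rfl fun i _ => by ring
        _ = 0 := by rw [hf, mul_zero]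
    exact_mod_cast h2
  have h3 := hb s
  rw [h1] at h3
  simpa [hD'] using h3

end Adapted

/-- The quotient of `ℤⁿ` by a saturated subgroup is torsion free, hence free, so that lifts of a basis
of the quotient complete a basis of the subgroup. -/
theorem exists_basis_of_saturated {n : ℕ} (S : AddSubgroup (Fin n → ℤ))
    (hS : ∀ (m : ℤ) (a : Fin n → ℤ), m ≠ 0 → m • a ∈ S → a ∈ S) :
    ∃ (k : ℕ) (_ : k ≤ n) (B : Module.Basis (Fin n) ℤ (Fin n → ℤ)),
      Submodule.span ℤ (Set.range fun j : {j : Fin n // k ≤ j.val} => B j.val) =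
        AddSubgroup.toIntSubmodule S := by
  set S' : Submodule ℤ (Fin n → ℤ) := AddSubgroup.toIntSubmodule S with hS'
  have htf : Module.IsTorsionFree ℤ ((Fin n → ℤ) ⧸ S') := by
    refine Module.IsTorsionFree.of_smul_eq_zero fun m x hx => ?_
    obtain ⟨a, rfl⟩ := Submodule.Quotient.mk_surjective _ x
    by_cases hm : m = 0
    · exact Or.inl hm
    · rw [← Submodule.Quotient.mk_smul, Submodule.Quotient.mk_eq_zero] at hx
      exact Or.inr ((Submodule.Quotient.mk_eq_zero _).2 (hS m a hm hx))
  have hfree : Module.Free ℤ ((Fin n → ℤ) ⧸ S') := Module.free_of_finite_type_torsion_free'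
  let bS := Module.finBasis ℤ S'
  let bQ := Module.finBasis ℤ ((Fin n → ℤ) ⧸ S')
  set r := Module.finrank ℤ S'
  set k := Module.finrank ℤ ((Fin n → ℤ) ⧸ S')
  let B₀ := bS.sumQuot bQ
  have hcard : k + r = n := by
    have h1 := Module.finrank_eq_card_basis B₀
    rw [Module.finrank_fintype_fun_eq_card] at h1
    simp at h1
    omega
  let e : Fin r ⊕ Fin k ≃ Fin n :=
    (Equiv.sumComm _ _).trans (finSumFinEquiv.trans (finCongr hcard))
  refine ⟨k, by omega, B₀.reindex e, ?_⟩
  have h1 : (Set.range fun j : {j : Fin n // k ≤ j.val} => B₀.reindex e j.val) =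
      Set.range fun i => (bS i : Fin n → ℤ) := by
    ext v
    constructor
    · rintro ⟨⟨j, hj⟩, rfl⟩
      obtain ⟨i | i, rfl⟩ := e.surjective j
      · exact ⟨i, by simp [B₀]⟩
      · exfalso
        have : (e (Sum.inr i)).val = i.val := by simp [e]
        rw [this] at hj
        exact absurd i.2 (by omega)
    · rintro ⟨i, rfl⟩
      exact ⟨⟨e (Sum.inl i), by simp [e]⟩, by simp [B₀]⟩
  rw [h1]
  have h2 := congrArg (Submodule.map S'.subtype) bS.span_eq
  rw [Submodule.map_span, Submodule.map_top, Submodule.range_subtype, ← Set.range_comp] at h2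
  exact h2

theorem exists_isAdapted {n d : ℕ} {ρ : Multiplicative (Fin n → ℤ) →* GL (Fin d) ℤ}
    (hρ : IsUnipotentRep ρ) (h : Fin d → ℤ) :
    ∃ (k : ℕ) (A : Matrix (Fin n) (Fin n) ℤ), IsAdapted ρ h k A := by
  obtain ⟨k, hk, B, hB⟩ := exists_basis_of_saturated (invariance ρ h) fun m a hm ha =>
    mem_invariance_of_zsmul_mem hρ h hm ha
  -- Among the bases obtained by changing signs, one has determinant one.
  obtain ⟨ε, hε⟩ : ∃ ε : Fin n → ℤˣ, (∏ j, (ε j : ℤ)) * (Pi.basisFun ℤ (Fin n)).det B = 1 := by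
    obtain h1 | h1 := Int.isUnit_iff.1 ((Pi.basisFun ℤ (Fin n)).isUnit_det B)
    · exact ⟨1, by rw [h1]; simp⟩
    · rcases n with _ | n
      · simp at h1
      · refine ⟨Pi.mulSingle 0 (-1), ?_⟩
        rw [h1, ← Units.coe_prod, Finset.prod_pi_mulSingle']
        simp
  let B' := B.unitsSMul ε
  have hB' : ∀ j, B' j = (ε j : ℤ) • B j := fun j => B.unitsSMul_apply j
  have hspan : Submodule.span ℤ (Set.range fun j : {j : Fin n // k ≤ j.val} => B' j.val) =
      AddSubgroup.toIntSubmodule (invariance ρ h) := by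
    rw [← hB]
    refine le_antisymm (Submodule.span_le.2 ?_) (Submodule.span_le.2 ?_)
    · rintro _ ⟨j, rfl⟩
      change B' j.val ∈ _
      rw [hB']
      exact Submodule.smul_mem _ _ (Submodule.subset_span ⟨j, rfl⟩)
    · rintro _ ⟨j, rfl⟩
      have h1 : B j.val = ((ε j.val)⁻¹ : ℤˣ).val • B' j.val := by
        rw [hB', smul_smul, Units.inv_mul, one_smul]
      change B j.val ∈ _
      rw [h1]
      exact Submodule.smul_mem _ _ (Submodule.subset_span ⟨j, rfl⟩)
  refine ⟨k, fun i j => B' j i, hk, ?_, ?_, ?_⟩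
  · have h1 : (Pi.basisFun ℤ (Fin n)).det B' = 1 := by
      have h2 : (B' : Fin n → Fin n → ℤ) = fun j => (ε j : ℤ) • B j := funext hB'
      rw [h2, AlternatingMap.map_smul_univ, smul_eq_mul, hε]
    exact h1
  · exact B'.linearIndependent.comp _ Subtype.val_injective
  · rw [← Submodule.span_int_eq_addSubgroupClosure]
    exact (congrArg Submodule.toAddSubgroup hspan).trans (by simp)

/-! ### Closures of images of monomial maps -/

theorem exists_pos_smul_lt {K ι : Type*} [Field K] [LinearOrder K] [IsStrictOrderedRing K]
    (s : Finset ι) (p q : ι → K) (hp : ∀ i ∈ s, 0 < p i) :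
    ∃ ε : K, 0 < ε ∧ ∀ i ∈ s, 0 < p i + ε * q i := by
  classical
  induction s using Finset.induction_on with
  | empty => exact ⟨1, one_pos, by simp⟩
  | insert i s _ ih =>
    obtain ⟨ε, hε, h⟩ := ih fun j hj => hp j (Finset.mem_insert_of_mem hj)
    have hpi := hp i (Finset.mem_insert_self i s)
    have hq : 0 < |q i| + 1 := by positivity
    -- Shrinking `ε` keeps the inequalities for `s`, since these hold for `0` and for `ε`.
    refine ⟨min ε (p i / (|q i| + 1)), lt_min hε (by positivity), fun j hj => ?_⟩
    set δ := min ε (p i / (|q i| + 1))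
    have hδ : 0 < δ := lt_min hε (by positivity)
    rcases Finset.mem_insert.1 hj with rfl | hj
    · have h1 : δ * (|q j| + 1) ≤ p j := (le_div_iff₀ hq).1 (min_le_right _ _)
      have h2 := neg_abs_le (q j)
      nlinarith
    · have h1 := h j hj
      have h2 := hp j (Finset.mem_insert_of_mem hj)
      rcases le_or_gt 0 (q j) with h3 | h3
      · positivity
      · have h4 : δ ≤ ε := min_le_left _ _
        nlinarith

/-- Gordan's theorem of the alternative: finitely many linear forms over an ordered field are either
positive at a common point, or they satisfy a nontrivial linear relation with nonnegative
coefficients. When a form `a i` is added, one passes to its kernel. -/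
theorem exists_forall_pos_or_exists_relation {K ι : Type*} [Field K] [LinearOrder K]
    [IsStrictOrderedRing K] (s : Finset ι) {V : Type*} [AddCommGroup V] [Module K V]
    (a : ι → V →ₗ[K] K) :
    (∃ x, ∀ i ∈ s, 0 < a i x) ∨
      ∃ m : ι → K, (∀ i ∈ s, 0 ≤ m i) ∧ (∃ i ∈ s, m i ≠ 0) ∧ ∑ i ∈ s, m i • a i = 0 := by
  classical
  induction s using Finset.induction_on generalizing V with
  | empty => exact Or.inl ⟨0, by simp⟩
  | insert i s hi ih =>
    have hupd : ∀ (m : ι → K) (c : K), ∑ j ∈ insert i s, Function.update m i c j • a j =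
        c • a i + ∑ j ∈ s, m j • a j := by
      intro m c
      rw [Finset.sum_insert hi, Function.update_self]
      congr 1
      refine Finset.sum_congr rfl fun j hj => ?_
      rw [Function.update_of_ne (ne_of_mem_of_not_mem hj hi)]
    have hnonneg : ∀ (m : ι → K) (c : K), (∀ j ∈ s, 0 ≤ m j) → 0 ≤ c →
        ∀ j ∈ insert i s, 0 ≤ Function.update m i c j := by
      intro m c hm hc j hj
      rcases Finset.mem_insert.1 hj with rfl | hj
      · simpa using hc
      · rw [Function.update_of_ne (ne_of_mem_of_not_mem hj hi)]; exact hm j hj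
    have hne : ∀ (m : ι → K) (c : K), (∃ j ∈ s, m j ≠ 0) →
        ∃ j ∈ insert i s, Function.update m i c j ≠ 0 := by
      rintro m c ⟨j, hj, hmj⟩
      refine ⟨j, Finset.mem_insert_of_mem hj, ?_⟩
      rwa [Function.update_of_ne (ne_of_mem_of_not_mem hj hi)]
    rcases ih a with ⟨x, hx⟩ | ⟨m, hm, hm0, hrel⟩
    swap
    · exact Or.inr ⟨Function.update m i 0, hnonneg m 0 hm le_rfl, hne m 0 hm0, by
        rw [hupd, hrel, zero_smul, zero_add]⟩
    by_cases hai : a i = 0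
    · refine Or.inr ⟨Function.update 0 i 1, hnonneg 0 1 (by simp) zero_le_one,
        ⟨i, Finset.mem_insert_self _ _, by simp⟩, ?_⟩
      rw [hupd, hai]; simp
    rcases lt_or_ge 0 (a i x) with hix | hix
    · exact Or.inl ⟨x, fun j hj => by
        rcases Finset.mem_insert.1 hj with rfl | hj
        exacts [hix, hx j hj]⟩
    obtain ⟨z, hz⟩ : ∃ z, 0 < a i z := by
      obtain ⟨z, hz⟩ : ∃ z, a i z ≠ 0 := by
        by_contra! hcon
        exact hai (LinearMap.ext hcon)
      rcases lt_or_gt_of_ne hz with hz | hz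
      · exact ⟨-z, by simpa using hz⟩
      · exact ⟨z, hz⟩
    rcases ih fun j => a j ∘ₗ (LinearMap.ker (a i)).subtype with ⟨y, hy⟩ | ⟨m, hm, hm0, hrel⟩
    · obtain ⟨ε, hε, h⟩ := exists_pos_smul_lt s (fun j => a j y) (fun j => a j z) hy
      refine Or.inl ⟨y + ε • z, fun j hj => ?_⟩
      rw [map_add, map_smul, smul_eq_mul]
      rcases Finset.mem_insert.1 hj with rfl | hj
      · have hyj : a j y = 0 := y.2
        rw [hyj, zero_add]
        positivity
      · exact h j hj
    · -- The relation on the kernel of `a i` is a multiple of `a i`; its value at `x` gives the sign.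
      set b := ∑ j ∈ s, m j • a j with hb
      have hbker : ∀ y, a i y = 0 → b y = 0 := by
        intro y hy
        have := LinearMap.congr_fun hrel ⟨y, hy⟩
        simpa [hb] using this
      have hbz : ∀ y, b y = (b z / a i z) * a i y := by
        intro y
        have h1 := hbker (y - (a i y / a i z) • z) (by
          rw [map_sub, map_smul, smul_eq_mul, div_mul_cancel₀ _ hz.ne', sub_self])
        rw [map_sub, map_smul, smul_eq_mul, sub_eq_zero] at h1
        rw [h1]; ring
      have hbx : 0 < b x := by
        obtain ⟨j, hj, hmj⟩ := hm0
        have h1 : b x = ∑ j ∈ s, m j * a j x := by simp [hb]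
        rw [h1]
        exact Finset.sum_pos' (fun l hl => mul_nonneg (hm l hl) (hx l hl).le)
          ⟨j, hj, mul_pos (lt_of_le_of_ne (hm j hj) hmj.symm) (hx j hj)⟩
      have hc : b z / a i z ≤ 0 := by
        by_contra! hcon
        have := mul_nonpos_of_nonneg_of_nonpos hcon.le hix
        rw [← hbz] at this
        exact absurd hbx this.not_gt
      refine Or.inr ⟨Function.update m i (-(b z / a i z)), hnonneg m _ hm (by linarith),
        hne m _ hm0, ?_⟩
      rw [hupd]
      refine LinearMap.ext fun y => ?_
      rw [LinearMap.add_apply, ← hb, hbz y]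
      simp

theorem baer_additive_units_complex : Module.Baer ℤ (Additive ℂˣ) := by
  let _ : DivisibleBy (Additive ℂˣ) ℕ := divisibleByOfSMulRightSurj _ _ fun {m} hm y => by
    obtain ⟨z, hz⟩ := IsAlgClosed.exists_pow_nat_eq (y.toMul : ℂ) (Nat.pos_of_ne_zero hm)
    have hz0 : z ≠ 0 := by
      rintro rfl
      rw [zero_pow hm] at hz
      exact y.toMul.ne_zero hz.symm
    exact ⟨Additive.ofMul (Units.mk0 z hz0), Additive.toMul.injective (Units.ext hz)⟩
  let _ : DivisibleBy (Additive ℂˣ) ℤ := AddGroup.divisibleByIntOfDivisibleByNat _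
  exact Module.Baer.of_divisible _

/-- The image of a homomorphism of complex tori is the common kernel of the characters that vanish
on it, because `ℂˣ` is divisible. -/
theorem exists_prod_zpow_eq {J I : Type*} [Fintype J] [Fintype I] (a : J → I → ℤ) (y : J → ℂˣ)
    (hy : ∀ m : J → ℤ, (∀ i, ∑ j, m j * a j i = 0) → ∏ j, y j ^ m j = 1) :
    ∃ u : I → ℂˣ, ∀ j, ∏ i, u i ^ a j i = y j := by
  classical
  let β : (J → ℤ) →ₗ[ℤ] (I → ℤ) := Fintype.linearCombination ℤ a
  let χ : (J → ℤ) →ₗ[ℤ] Additive ℂˣ :=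
    Fintype.linearCombination ℤ fun j => Additive.ofMul (y j)
  have hle : LinearMap.ker β ≤ LinearMap.ker χ := by
    intro m hm
    have h1 : ∀ i, ∑ j, m j * a j i = 0 := by
      intro i
      have := congrFun (LinearMap.mem_ker.1 hm) i
      simpa [β, Fintype.linearCombination_apply] using this
    have h2 := congrArg Additive.ofMul (hy m h1)
    rw [ofMul_prod] at h2
    rw [LinearMap.mem_ker, Fintype.linearCombination_apply]
    exact h2
  obtain ⟨g, hg⟩ := baer_additive_units_complex.extension_property
    ((LinearMap.ker β).liftQ β le_rfl)
    (LinearMap.ker_eq_bot.1 (Submodule.ker_liftQ_eq_bot _ _ _ le_rfl))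
    ((LinearMap.ker β).liftQ χ hle)
  refine ⟨fun i => (g (Pi.single i 1)).toMul, fun j => ?_⟩
  have h1 := LinearMap.congr_fun hg (Submodule.Quotient.mk (Pi.single j 1))
  have h2 : β (Pi.single j 1) = a j := by simp [β, Fintype.linearCombination_apply_single]
  have h3 : χ (Pi.single j 1) = Additive.ofMul (y j) := by
    simp [χ, Fintype.linearCombination_apply_single]
  rw [LinearMap.comp_apply, Submodule.liftQ_apply, Submodule.liftQ_apply, h2, h3] at h1
  have h4 : a j = ∑ i, a j i • (Pi.single i 1 : I → ℤ) := by
    ext i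
    simp [Finset.sum_apply, Pi.single_apply]
  apply Additive.ofMul.injective
  rw [← h1]
  conv_rhs => rw [h4, map_sum]
  rw [ofMul_prod]
  refine Finset.sum_congr rfl fun i _ => ?_
  rw [map_zsmul]
  rfl

section Toric

variable {n k : ℕ} {A : Matrix (Fin n) (Fin n) ℤ}

/-- The binomials that vanish on the image of the monomial map: the exponent vectors `α` and `β` pair
equally with the last columns of `A`. -/
def toricBinomials (k : ℕ) (A : Matrix (Fin n) (Fin n) ℤ) : Set (MvPolynomial (Fin n) ℂ) :=
  {g | ∃ α β : Fin n →₀ ℕ, α ≠ β ∧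
    (∀ i : {i : Fin n // k ≤ i.val}, ∑ j, (α j : ℤ) * A j i.val = ∑ j, (β j : ℤ) * A j i.val) ∧
    g = MvPolynomial.monomial α 1 - MvPolynomial.monomial β 1}

theorem eval_monomial_one (α : Fin n →₀ ℕ) (x : Fin n → ℂ) :
    MvPolynomial.eval x (MvPolynomial.monomial α 1) = ∏ j, x j ^ α j := by
  rw [MvPolynomial.eval_monomial, one_mul, Finsupp.prod_fintype _ _ fun _ => pow_zero _]

theorem eval_toricBinomials_of_mem_monomialImage {x : Fin n → ℂ} (hx : x ∈ monomialImage k A)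
    {g : MvPolynomial (Fin n) ℂ} (hg : g ∈ toricBinomials k A) : MvPolynomial.eval x g = 0 := by
  obtain ⟨α, β, -, hαβ, rfl⟩ := hg
  obtain ⟨u, rfl⟩ := hx
  have key : ∀ γ : Fin n →₀ ℕ, ∏ j, (∏ i : {i : Fin n // k ≤ i.val}, (u i : ℂ) ^ A j i.val) ^ γ j =
      ∏ i : {i : Fin n // k ≤ i.val}, (u i : ℂ) ^ ∑ j, (γ j : ℤ) * A j i.val := by
    intro γ
    simp only [← Finset.prod_pow]
    rw [Finset.prod_comm]
    refine Finset.prod_congr rfl fun i _ => ?_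
    have h1 : ∀ s : Finset (Fin n), ∏ j ∈ s, ((u i : ℂ) ^ A j i.val) ^ γ j =
        (u i : ℂ) ^ ∑ j ∈ s, (γ j : ℤ) * A j i.val := by
      intro s
      induction s using Finset.induction_on with
      | empty => simp
      | insert j s hj ih =>
        rw [Finset.prod_insert hj, Finset.sum_insert hj, ih, zpow_add₀ (u i).ne_zero, mul_comm
          (γ j : ℤ), zpow_mul, zpow_natCast]
    exact h1 _
  rw [map_sub, eval_monomial_one, eval_monomial_one, key, key]
  simp only [hαβ, sub_self]

/-- A relation `m` between the rows of the exponent matrix gives the equation `x ^ m⁺ = x ^ m⁻`. -/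
theorem prod_pow_toNat_eq {x : Fin n → ℂ} (hx : ∀ g ∈ toricBinomials k A, MvPolynomial.eval x g = 0)
    (m : Fin n → ℤ) (hm : ∀ i : {i : Fin n // k ≤ i.val}, ∑ j, m j * A j i.val = 0) :
    ∏ j, x j ^ (m j).toNat = ∏ j, x j ^ (-m j).toNat := by
  let α : Fin n →₀ ℕ := Finsupp.equivFunOnFinite.symm fun j => (m j).toNat
  let β : Fin n →₀ ℕ := Finsupp.equivFunOnFinite.symm fun j => (-m j).toNat
  by_cases hαβ : α = β
  · refine Finset.prod_congr rfl fun j _ => ?_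
    have : α j = β j := by rw [hαβ]
    change x j ^ α j = x j ^ β j
    rw [this]
  · have h1 := hx (MvPolynomial.monomial α 1 - MvPolynomial.monomial β 1)
      ⟨α, β, hαβ, fun i => ?_, rfl⟩
    · rw [map_sub, eval_monomial_one, eval_monomial_one, sub_eq_zero] at h1
      exact h1
    · rw [← sub_eq_zero, ← Finset.sum_sub_distrib, ← hm i]
      refine Finset.sum_congr rfl fun j _ => ?_
      rw [← sub_mul]
      congr 1
      change ((m j).toNat : ℤ) - ((-m j).toNat : ℤ) = m j
      omega

/-- At a common zero `x` of the toric binomials some one-parameter subgroup of the torus is constant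
in the coordinates with `x j ≠ 0` and tends to zero in the others. By Gordan's theorem, otherwise
some binomial would be nonzero at `x`. -/
theorem exists_rat_direction {x : Fin n → ℂ}
    (hx : ∀ g ∈ toricBinomials k A, MvPolynomial.eval x g = 0) :
    ∃ w : {i : Fin n // k ≤ i.val} → ℚ, ∀ j, (x j ≠ 0 → ∑ i, (A j i.val : ℚ) * w i = 0) ∧
      (x j = 0 → 0 < ∑ i, (A j i.val : ℚ) * w i) := by
  classical
  let a : Fin n → ({i : Fin n // k ≤ i.val} → ℚ) →ₗ[ℚ] ℚ := fun j =>
    Fintype.linearCombination ℚ fun i : {i : Fin n // k ≤ i.val} => (A j i.val : ℚ)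
  have ha : ∀ j w, a j w = ∑ i, (A j i.val : ℚ) * w i := by
    intro j w
    simp [a, Fintype.linearCombination_apply, mul_comm]
  let V : Submodule ℚ ({i : Fin n // k ≤ i.val} → ℚ) :=
    ⨅ j : {j : Fin n // x j ≠ 0}, LinearMap.ker (a j.val)
  rcases exists_forall_pos_or_exists_relation (Finset.univ.filter fun j => x j = 0)
    (fun j => a j ∘ₗ V.subtype) with ⟨w, hw⟩ | ⟨m, hm, ⟨j₀, hj₀, hmj₀⟩, hrel⟩
  · refine ⟨w, fun j => ⟨fun hj => ?_, fun hj => ?_⟩⟩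
    · rw [← ha]
      exact (Submodule.mem_iInf _).1 w.2 ⟨j, hj⟩
    · rw [← ha]
      exact hw j (by simpa using hj)
  · exfalso
    have hker : V ≤ LinearMap.ker (∑ j ∈ Finset.univ.filter (fun j => x j = 0), m j • a j) := by
      intro w hw
      have := LinearMap.congr_fun hrel ⟨w, hw⟩
      simpa using this
    obtain ⟨c, hc⟩ := (Submodule.mem_span_range_iff_exists_fun ℚ).1
      (mem_span_of_iInf_ker_le_ker hker)
    let q : Fin n → ℚ := fun j => if hj : x j = 0 then m j else -c ⟨j, hj⟩
    have hq : ∑ j, q j • a j = 0 := by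
      rw [← Fintype.sum_subtype_add_sum_subtype (fun j => x j = 0) (fun j => q j • a j)]
      have h1 : ∑ j : {j : Fin n // x j = 0}, q j.val • a j.val =
          ∑ j ∈ Finset.univ.filter (fun j => x j = 0), m j • a j := by
        rw [Finset.sum_subtype (p := fun j => x j = 0) _ (by simp)]
        exact Finset.sum_congr rfl fun j _ => by simp [q, j.2]
      have h2 : ∑ j : {j : Fin n // ¬ x j = 0}, q j.val • a j.val = -∑ j, c j • a j.val := by
        rw [← Finset.sum_neg_distrib]
        exact Finset.sum_congr rfl fun j _ => by simp [q, j.2]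
      rw [h1, h2, hc, add_neg_cancel]
    -- The relation `b` has nonnegative entries where `x` vanishes, and one of them is positive. So of
    -- the two monomials with exponents `b⁺` and `b⁻` exactly one vanishes at `x`.
    obtain ⟨D, b, hD, hb⟩ := exists_int_multiple q
    have hD' : (0 : ℚ) < D := by exact_mod_cast Nat.pos_of_ne_zero hD
    have hbA : ∀ i : {i : Fin n // k ≤ i.val}, ∑ j, b j * A j i.val = 0 := by
      intro i
      have h1 := LinearMap.congr_fun hq (Pi.single i 1)
      have h2 : ∑ j, q j * (A j i.val : ℚ) = 0 := by
        simpa [ha, Pi.single_apply] using h1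
      have h3 : ((∑ j, b j * A j i.val : ℤ) : ℚ) = D * ∑ j, q j * (A j i.val : ℚ) := by
        push_cast
        rw [Finset.mul_sum]
        exact Finset.sum_congr rfl fun j _ => by rw [hb]; ring
      rw [h2, mul_zero] at h3
      exact_mod_cast h3
    have hprod := prod_pow_toNat_eq hx b hbA
    have hbG : ∀ j, x j = 0 → (b j : ℚ) = D * m j := by
      intro j hj
      rw [hb]; simp [q, hj]
    have hleft : ∏ j, x j ^ (b j).toNat = 0 := by
      have hxj : x j₀ = 0 := by simpa using hj₀
      refine Finset.prod_eq_zero (Finset.mem_univ j₀) ?_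
      have h1 : 0 < b j₀ := by
        have : (0 : ℚ) < b j₀ := by
          rw [hbG j₀ hxj]
          exact mul_pos hD' (lt_of_le_of_ne (hm j₀ hj₀) hmj₀.symm)
        exact_mod_cast this
      rw [hxj, zero_pow (by omega)]
    have hright : ∏ j, x j ^ (-b j).toNat ≠ 0 := by
      refine Finset.prod_ne_zero_iff.2 fun j _ => ?_
      by_cases hxj : x j = 0
      · have h1 : 0 ≤ b j := by
          have : (0 : ℚ) ≤ b j := by
            rw [hbG j hxj]
            exact mul_nonneg hD'.le (hm j (by simpa using hxj))
          exact_mod_cast this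
        rw [show (-b j).toNat = 0 by omega, pow_zero]
        exact one_ne_zero
      · exact pow_ne_zero _ hxj
    exact hright (hprod ▸ hleft)

/-- Some point of the torus has the nonzero coordinates of `x`: a character that is trivial on the
projection of the torus to these coordinates is trivial at `x`, by the binomials whose exponents
involve these coordinates only. -/
theorem exists_torus_point {x : Fin n → ℂ}
    (hx : ∀ g ∈ toricBinomials k A, MvPolynomial.eval x g = 0) :
    ∃ u : {i : Fin n // k ≤ i.val} → ℂˣ, ∀ j, x j ≠ 0 → ∏ i, (u i : ℂ) ^ A j i.val = x j := by
  classical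
  obtain ⟨u, hu⟩ := exists_prod_zpow_eq
    (fun (j : {j : Fin n // x j ≠ 0}) (i : {i : Fin n // k ≤ i.val}) => A j.val i.val)
    (fun j => Units.mk0 (x j.val) j.2) (by
      intro m hm
      let b : Fin n → ℤ := fun j => if hj : x j ≠ 0 then m ⟨j, hj⟩ else 0
      have hbF : ∀ j : {j : Fin n // x j ≠ 0}, b j.val = m j := fun j => by simp [b, j.2]
      have hbG : ∀ j : {j : Fin n // ¬ x j ≠ 0}, b j.val = 0 := fun j => dif_neg j.2
      have hprod := prod_pow_toNat_eq hx b (fun i => by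
        rw [← Fintype.sum_subtype_add_sum_subtype (fun j => x j ≠ 0) (fun j => b j * A j i.val)]
        simp only [hbF, hbG, zero_mul, Finset.sum_const_zero, add_zero]
        exact hm i)
      rw [← Fintype.prod_subtype_mul_prod_subtype (fun j => x j ≠ 0),
        ← Fintype.prod_subtype_mul_prod_subtype (fun j => x j ≠ 0)
          (fun j => x j ^ (-b j).toNat)] at hprod
      simp only [hbF, hbG, neg_zero, Int.toNat_zero, pow_zero, Finset.prod_const_one,
        mul_one] at hprod
      have hpos : ∏ j, (Units.mk0 (x j.val) j.2 : ℂˣ) ^ (m j).toNat =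
          ∏ j, (Units.mk0 (x j.val) j.2 : ℂˣ) ^ (-m j).toNat := by
        apply Units.ext
        push_cast
        exact hprod
      have hsplit : ∀ j, (Units.mk0 (x j.val) j.2 : ℂˣ) ^ m j =
          Units.mk0 (x j.val) j.2 ^ (m j).toNat / Units.mk0 (x j.val) j.2 ^ (-m j).toNat := by
        intro j
        rw [← zpow_natCast, ← zpow_natCast, div_eq_mul_inv, ← zpow_sub]
        congr 1
        omega
      simp only [hsplit, Finset.prod_div_distrib, hpos, div_self'])
  refine ⟨u, fun j hj => ?_⟩
  have := congrArg Units.val (hu ⟨j, hj⟩)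
  push_cast at this
  exact this

/-- The point `x` is the limit for `s → ∞` of the images of `u i * exp (-s * w i)`, where `u` is the
torus point and `w` the direction adapted to `x`. -/
theorem mem_closure_monomialImage {x : Fin n → ℂ}
    (hx : ∀ g ∈ toricBinomials k A, MvPolynomial.eval x g = 0) :
    x ∈ closure (monomialImage k A) := by
  obtain ⟨w, hw⟩ := exists_rat_direction hx
  obtain ⟨u, hu⟩ := exists_torus_point hx
  let us : ℝ → {i : Fin n // k ≤ i.val} → ℂˣ := fun s i =>
    u i * Units.mk0 (Complex.exp (-(s * (w i : ℂ)))) (Complex.exp_ne_zero _)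
  have hus : ∀ s j, ∏ i, (us s i : ℂ) ^ A j i.val = (∏ i, (u i : ℂ) ^ A j i.val) *
      Complex.exp (-(s * ((∑ i, (A j i.val : ℚ) * w i : ℚ) : ℂ))) := by
    intro s j
    simp only [us, Units.val_mul, Units.val_mk0, mul_zpow, Finset.prod_mul_distrib]
    congr 1
    simp only [← Complex.exp_int_mul]
    rw [← Complex.exp_sum]
    congr 1
    push_cast
    rw [Finset.mul_sum, ← Finset.sum_neg_distrib]
    exact Finset.sum_congr rfl fun i _ => by ring
  refine mem_closure_of_tendsto (f := fun (s : ℝ) j => ∏ i, (us s i : ℂ) ^ A j i.val)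
    (b := Filter.atTop) (tendsto_pi_nhds.2 fun j => ?_) (Filter.Eventually.of_forall fun s =>
      ⟨us s, rfl⟩)
  simp only [hus]
  by_cases hj : x j = 0
  · rw [hj, ← mul_zero (∏ i, (u i : ℂ) ^ A j i.val)]
    refine Filter.Tendsto.const_mul _ ?_
    rw [tendsto_zero_iff_norm_tendsto_zero]
    simp only [Complex.norm_exp]
    refine Real.tendsto_exp_atBot.comp ?_
    have hpos : (0 : ℝ) < ((∑ i, (A j i.val : ℚ) * w i : ℚ) : ℝ) := by
      exact_mod_cast (hw j).2 hj
    have h1 : ∀ s : ℝ, (-((s : ℂ) * ((∑ i, (A j i.val : ℚ) * w i : ℚ) : ℂ))).re =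
        -(s * ((∑ i, (A j i.val : ℚ) * w i : ℚ) : ℝ)) := by
      intro s
      rw [← Complex.ofReal_ratCast, ← Complex.ofReal_mul, ← Complex.ofReal_neg,
        Complex.ofReal_re]
    simp only [h1]
    exact Filter.tendsto_neg_atTop_atBot.comp (Filter.tendsto_id.atTop_mul_const hpos)
  · rw [(hw j).1 hj, hu j hj]
    simp

theorem zeroLocus_toricBinomials :
    {x | ∀ g ∈ toricBinomials k A, MvPolynomial.eval x g = 0} = closure (monomialImage k A) := by
  refine Set.Subset.antisymm (fun x hx => mem_closure_monomialImage hx) ?_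
  refine closure_minimal (fun x hx g hg => eval_toricBinomials_of_mem_monomialImage hx hg) ?_
  simp only [Set.ofPred_forall]
  exact isClosed_iInter fun g => isClosed_iInter fun _ =>
    isClosed_eq (MvPolynomial.continuous_eval g) continuous_const

theorem exists_binomials_definesMonomialClosure (k : ℕ) (A : Matrix (Fin n) (Fin n) ℤ) :
    ∃ (e : ℕ) (f : Fin e → MvPolynomial (Fin n) ℂ),
      (∀ b, IsBinomial (f b)) ∧ DefinesMonomialClosure k A f := by
  obtain ⟨s, hs, hspan⟩ := (Submodule.fg_span_iff_fg_span_finset_subset (toricBinomials k A)).1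
    (IsNoetherian.noetherian (Ideal.span (toricBinomials k A)))
  refine ⟨s.card, fun b => (s.equivFin.symm b).val, fun b => ?_, ?_⟩
  · obtain ⟨α, β, hαβ, -, hg⟩ := hs (s.equivFin.symm b).2
    exact ⟨α, β, hαβ, hg⟩
  · rw [DefinesMonomialClosure, ← zeroLocus_toricBinomials]
    ext x
    constructor
    · intro hx g hg
      have h1 : Ideal.span (s : Set (MvPolynomial (Fin n) ℂ)) ≤
          RingHom.ker (MvPolynomial.eval x) := by
        refine Ideal.span_le.2 fun g hg => ?_
        have := hx (s.equivFin ⟨g, hg⟩)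
        rwa [Equiv.symm_apply_apply] at this
      have h2 : g ∈ Ideal.span (s : Set (MvPolynomial (Fin n) ℂ)) := by
        rw [Ideal.span, ← hspan]
        exact Submodule.subset_span hg
      exact h1 h2
    · intro hx b
      exact hx _ (hs (s.equivFin.symm b).2)

end Toric

/-! ### The equations of the closure -/

theorem differentiable_of_mem_polyFun {σ : Type*} [Fintype σ] {F : (σ → ℂ) → ℂ}
    (hF : F ∈ polyFun σ) : Differentiable ℂ F := by
  obtain ⟨p, hp⟩ := mem_polyFun.1 hF
  rw [← funext hp]
  clear hp hF
  induction p using MvPolynomial.induction_on with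
  | C a => simp
  | add p q hp hq => simp only [map_add]; exact hp.add hq
  | mul_X p i hp =>
    simp only [map_mul, MvPolynomial.eval_X]; exact hp.mul (differentiable_apply i)

section Equations

variable {n d : ℕ} {ρ : Multiplicative (Fin n → ℤ) →* GL (Fin d) ℤ} {h : Fin d → ℤ} {k : ℕ}
  {A : Matrix (Fin n) (Fin n) ℤ}

theorem commute_newLog (s t : Fin n) : Commute (newLog ρ A s) (newLog ρ A t) :=
  commute_sum_smul (commute_logMonodromy ρ) _ _

theorem isNilpotent_newLog (hρ : IsUnipotentRep ρ) (s : Fin n) : IsNilpotent (newLog ρ A s) :=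
  isNilpotent_sum_smul (commute_logMonodromy ρ) (isNilpotent_logMonodromy hρ) _

theorem exp_neg_sum_mulVec_mem_polyFun {ι : Type*} [Fintype ι]
    {M : ι → Matrix (Fin d) (Fin d) ℂ} (hcomm : ∀ s t, Commute (M s) (M t))
    (hnil : ∀ s, IsNilpotent (M s)) (v : Fin d → ℂ) (i : Fin d) :
    (fun w : ι → ℂ => (NormedSpace.exp (-∑ s, w s • M s) *ᵥ v) i) ∈ polyFun ι := by
  refine exp_mulVec_mem_polyFun (X := fun w : ι → ℂ => -∑ s, w s • M s) (v := fun _ => v)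
    (fun a b => ?_) (fun w => (isNilpotent_sum_smul hcomm hnil w).neg)
    (fun i => const_mem_polyFun _) i
  simp only [Matrix.neg_apply, Matrix.sum_apply, Matrix.smul_apply]
  exact (polyFun ι).neg_mem (sum_mem_polyFun _ fun s _ =>
    (polyFun ι).mul_mem (coord_mem_polyFun s) (const_mem_polyFun _))

theorem differentiable_equationA (hρ : IsUnipotentRep ρ) (hk : k ≤ n)
    (p : Fin k → MvPolynomial (Fin d) ℂ) (i : Fin d) :
    Differentiable ℂ (equationA ρ h hk A p i) := by
  have h1 : (fun v : Fin d → ℂ => expEmbedding ρ h hk A (fun s => MvPolynomial.eval v (p s)) i) ∈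
      polyFun (Fin d) :=
    comp_mem_polyFun
      (exp_neg_sum_mulVec_mem_polyFun (fun s t => commute_newLog _ _)
        (fun s => isNilpotent_newLog hρ _) (toComplex h) i)
      fun s => eval_mem_polyFun (p s)
  have h2 := differentiable_of_mem_polyFun ((polyFun _).sub_mem (coord_mem_polyFun i) h1)
  exact h2.comp differentiable_snd

theorem differentiable_equationB (hk : k ≤ n) (p : Fin k → MvPolynomial (Fin d) ℂ)
    (g : MvPolynomial (Fin n) ℂ) : Differentiable ℂ (equationB hk A p g) := by
  have h1 : ∀ s, Differentiable ℂ fun q : (Fin n → ℂ) × (Fin d → ℂ) =>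
      MvPolynomial.eval q.2 (p s) := fun s =>
    (differentiable_of_mem_polyFun (eval_mem_polyFun (p s))).comp differentiable_snd
  refine (differentiable_of_mem_polyFun (eval_mem_polyFun g)).comp (differentiable_pi.2 fun j => ?_)
  have h2 : Differentiable ℂ fun q : (Fin n → ℂ) × (Fin d → ℂ) => q.1 j :=
    differentiable_pi.1 differentiable_fst j
  refine h2.mul (Differentiable.cexp ?_)
  exact ((Differentiable.fun_sum fun s _ => (h1 s).const_mul _).const_mul _).neg

theorem differentiable_param (hρ : IsUnipotentRep ρ) : Differentiable ℂ (param ρ h) := by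
  refine Differentiable.prodMk (differentiable_pi.2 fun j => ?_) (differentiable_pi.2 fun i => ?_)
  · exact ((differentiable_apply j).const_mul _).cexp
  · exact differentiable_of_mem_polyFun (exp_neg_sum_mulVec_mem_polyFun (commute_logMonodromy ρ)
      (isNilpotent_logMonodromy hρ) _ i)

theorem isOpen_bundle (n d : ℕ) : IsOpen (bundle n d) := by
  simp only [bundle, Set.ofPred_forall]
  exact isOpen_iInter_of_finite fun j =>
    isOpen_lt (((continuous_apply j).comp continuous_fst).norm) continuous_const

theorem norm_exp_two_pi_I_mul_lt_one_iff (z : ℂ) :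
    ‖Complex.exp (2 * Real.pi * Complex.I * z)‖ < 1 ↔ 0 < z.im := by
  rw [Complex.norm_exp, Real.exp_lt_one_iff]
  have h1 : (2 * Real.pi * Complex.I * z).re = -(2 * Real.pi * z.im) := by simp
  rw [h1, neg_lt_zero]
  exact mul_pos_iff_of_pos_left Real.two_pi_pos

theorem param_mem_bundle {z : Fin n → ℂ} (hz : ∀ j, 0 < (z j).im) : param ρ h z ∈ bundle n d :=
  fun j => (norm_exp_two_pi_I_mul_lt_one_iff (z j)).2 (hz j)

/-- In the coordinates `z = A w` the vector component of the parametrization depends only on the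
first `k` coordinates, since the other logarithms kill `h`. -/
theorem IsAdapted.param_mulVec (hρ : IsUnipotentRep ρ) (hA : IsAdapted ρ h k A) (w : Fin n → ℂ) :
    param ρ h (fun j => ∑ s, (A j s : ℂ) * w s) =
      (fun j => Complex.exp (2 * Real.pi * Complex.I * ∑ s, (A j s : ℂ) * w s),
        expEmbedding ρ h hA.le A fun s => w (Fin.castLE hA.le s)) := by
  refine Prod.ext rfl ?_
  change NormedSpace.exp (-∑ j, (∑ s, (A j s : ℂ) * w s) • logMonodromy ρ j) *ᵥ toComplex h =
    NormedSpace.exp (-∑ s : Fin k, w (Fin.castLE hA.le s) • newLog ρ A (Fin.castLE hA.le s)) *ᵥ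
      toComplex h
  have h1 : ∑ j, (∑ s, (A j s : ℂ) * w s) • logMonodromy ρ j = ∑ s, w s • newLog ρ A s := by
    simp only [newLog, Finset.sum_smul, Finset.smul_sum]
    rw [Finset.sum_comm]
    exact Finset.sum_congr rfl fun s _ => Finset.sum_congr rfl fun j _ => by
      rw [smul_smul, mul_comm]
  set X := ∑ s : Fin k, w (Fin.castLE hA.le s) • newLog ρ A (Fin.castLE hA.le s)
  set Y := ∑ j : {j : Fin n // k ≤ j.val}, w j.val • newLog ρ A j.val
  have hXY : Commute X Y :=
    Commute.sum_right _ _ _ fun _ _ => Commute.sum_left _ _ _ fun _ _ =>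
      ((commute_newLog _ _).smul_left _).smul_right _
  have hY : IsNilpotent Y := isNilpotent_sum_smul (fun _ _ => commute_newLog _ _)
    (fun _ => isNilpotent_newLog hρ _) _
  have hYh : Y *ᵥ toComplex h = 0 := by
    rw [Matrix.sum_mulVec]
    refine Finset.sum_eq_zero fun j _ => ?_
    rw [Matrix.smul_mulVec, hA.newLog_mulVec_eq_zero hρ, smul_zero]
  rw [h1, sum_eq_sum_castLE_add hA.le, neg_add, Matrix.exp_add_of_commute _ _
    hXY.neg_left.neg_right, ← Matrix.mulVec_mulVec, (exp_mulVec_eq_self_iff hY.neg _).2]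
  rw [Matrix.neg_mulVec, hYh, neg_zero]

theorem IsAdapted.exists_coordinates (hA : IsAdapted ρ h k A) (z : Fin n → ℂ) :
    ∃ w : Fin n → ℂ, (fun j => ∑ s, (A j s : ℂ) * w s) = z := by
  let B : Matrix (Fin n) (Fin n) ℂ := (Int.castRingHom ℂ).mapMatrix A
  have hB : IsUnit B.det := by
    rw [← RingHom.map_det, hA.det_eq_one]; simp
  refine ⟨B⁻¹ *ᵥ z, ?_⟩
  change B *ᵥ (B⁻¹ *ᵥ z) = z
  rw [Matrix.mulVec_mulVec, Matrix.mul_nonsing_inv _ hB, Matrix.one_mulVec]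

theorem IsAdapted.exists_invertsEmbedding (hρ : IsUnipotentRep ρ) (hA : IsAdapted ρ h k A) :
    ∃ p : Fin k → MvPolynomial (Fin d) ℂ, InvertsEmbedding ρ h hA.le A p :=
  exists_polynomial_inverse (fun _ _ => commute_newLog _ _) (fun _ => isNilpotent_newLog hρ _)
    (toComplex h) fun w hw => hA.eq_zero_of_sum_newLog_mulVec hρ w hw

theorem prod_exp_zpow (w : {i : Fin n // k ≤ i.val} → ℂ) (j : Fin n) :
    ∏ i, Complex.exp (2 * Real.pi * Complex.I * w i) ^ A j i.val =
      Complex.exp (2 * Real.pi * Complex.I * ∑ i, (A j i.val : ℂ) * w i) := by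
  simp only [← Complex.exp_int_mul]
  rw [← Complex.exp_sum, Finset.mul_sum]
  congr 1
  exact Finset.sum_congr rfl fun i _ => by ring

theorem mem_monomialImage_iff {x : Fin n → ℂ} :
    x ∈ monomialImage k A ↔ ∃ w : {i : Fin n // k ≤ i.val} → ℂ,
      ∀ j, x j = Complex.exp (2 * Real.pi * Complex.I * ∑ i, (A j i.val : ℂ) * w i) := by
  constructor
  · rintro ⟨u, rfl⟩
    refine ⟨fun i => Complex.log (u i) / (2 * Real.pi * Complex.I), fun j => ?_⟩
    rw [← prod_exp_zpow]
    refine Finset.prod_congr rfl fun i _ => ?_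
    rw [mul_div_cancel₀ _ Complex.two_pi_I_ne_zero, Complex.exp_log (u i).ne_zero]
  · rintro ⟨w, hw⟩
    refine ⟨fun i => Units.mk0 (Complex.exp (2 * Real.pi * Complex.I * w i))
      (Complex.exp_ne_zero _), ?_⟩
    ext j
    rw [hw, ← prod_exp_zpow]
    rfl

/-- On the sheet, the equations hold because the polynomials `p s` recover the first `k` coordinates
of `w = A⁻¹ z`, so that the remaining factor of `t` is a point of the torus. Conversely, a solution
is a limit of such points by the hypothesis on `f`. -/
theorem IsAdapted.sheetClosure_eq (hρ : IsUnipotentRep ρ) (hA : IsAdapted ρ h k A)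
    {p : Fin k → MvPolynomial (Fin d) ℂ} {e : ℕ} {f : Fin e → MvPolynomial (Fin n) ℂ}
    (hp : InvertsEmbedding ρ h hA.le A p) (hf : DefinesMonomialClosure k A f) :
    sheetClosure ρ h = {q ∈ bundle n d | (∀ i, equationA ρ h hA.le A p i q = 0) ∧
      (∀ b, equationB hA.le A p (f b) q = 0)} := by
  have hf' : ∀ x, (∀ b, MvPolynomial.eval x (f b) = 0) ↔ x ∈ closure (monomialImage k A) :=
    fun x => Set.ext_iff.1 hf x
  refine Set.Subset.antisymm ?_ ?_
  · rintro q ⟨hq, hqb⟩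
    refine ⟨hqb, ?_⟩
    have hclosed : IsClosed {q | (∀ i, equationA ρ h hA.le A p i q = 0) ∧
        (∀ b, equationB hA.le A p (f b) q = 0)} := by
      simp only [Set.ofPred_and, Set.ofPred_forall]
      exact (isClosed_iInter fun i => isClosed_eq (differentiable_equationA hρ hA.le p i).continuous
        continuous_const).inter (isClosed_iInter fun b => isClosed_eq
          (differentiable_equationB hA.le p (f b)).continuous continuous_const)
    refine closure_minimal ?_ hclosed hq
    rintro _ ⟨z, -, rfl⟩
    obtain ⟨w, rfl⟩ := hA.exists_coordinates z
    rw [hA.param_mulVec hρ w]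
    have hpw : ∀ s, MvPolynomial.eval (expEmbedding ρ h hA.le A fun s => w (Fin.castLE hA.le s))
        (p s) = w (Fin.castLE hA.le s) := fun s => hp _ s
    refine ⟨fun i => ?_, fun b => ?_⟩
    · simp only [equationA, hpw, sub_self]
    · simp only [equationB, hpw]
      refine (hf' _).2 (subset_closure (mem_monomialImage_iff.2 ⟨fun i => w i.val, fun j => ?_⟩)) b
      rw [← Complex.exp_add, sum_eq_sum_castLE_add hA.le]
      congr 1
      ring
  · rintro q ⟨hqb, hqA, hqB⟩
    refine ⟨?_, hqb⟩
    let W : Fin k → ℂ := fun s => MvPolynomial.eval q.2 (p s)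
    let E : Fin n → ℂ := fun j =>
      2 * Real.pi * Complex.I * ∑ s, (A j (Fin.castLE hA.le s) : ℂ) * W s
    have hq2 : q.2 = expEmbedding ρ h hA.le A W := funext fun i => sub_eq_zero.1 (hqA i)
    let x : Fin n → ℂ := fun j => q.1 j * Complex.exp (-E j)
    have hx : x ∈ closure (monomialImage k A) := (hf' x).1 hqB
    -- Multiplying back by the exponential factors, nearby torus points become points of the sheet.
    let Φ : (Fin n → ℂ) → (Fin n → ℂ) × (Fin d → ℂ) := fun y =>
      (fun j => y j * Complex.exp (E j), q.2)
    have hΦ : Continuous Φ := by fun_prop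
    have hΦx : Φ x = q := by
      refine Prod.ext (funext fun j => ?_) rfl
      change q.1 j * Complex.exp (-E j) * Complex.exp (E j) = q.1 j
      rw [mul_assoc, ← Complex.exp_add, neg_add_cancel, Complex.exp_zero, mul_one]
    have h1 : q ∈ closure (Φ '' monomialImage k A) :=
      image_closure_subset_closure_image hΦ ⟨x, hx, hΦx⟩
    have h2 := (isOpen_bundle n d).inter_closure ⟨hqb, h1⟩
    refine closure_mono ?_ h2
    rintro _ ⟨hb, y, hy, rfl⟩
    obtain ⟨w, hw⟩ := mem_monomialImage_iff.1 hy
    have h3 : param ρ h (fun j => ∑ s, (A j s : ℂ) * glue W w s) = Φ y := by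
      rw [hA.param_mulVec hρ]
      refine Prod.ext (funext fun j => ?_) ?_
      · change Complex.exp (2 * Real.pi * Complex.I * ∑ s, (A j s : ℂ) * glue W w s) =
          y j * Complex.exp (E j)
        rw [hw, ← Complex.exp_add, sum_eq_sum_castLE_add hA.le]
        simp only [glue_castLE, glue_val, E]
        congr 1
        ring
      · simp only [glue_castLE]
        exact hq2.symm
    refine ⟨_, fun j => ?_, h3⟩
    rw [← h3] at hb
    exact (norm_exp_two_pi_I_mul_lt_one_iff _).1 (hb j)

end Equations

/-! ### Analyticity, reducedness and irreducibility -/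

section Analytic

variable {E : Type*} [NormedAddCommGroup E] [NormedSpace ℂ E]

theorem isAnalyticSubset_of_eq_zeroLocus {Ω X : Set E} {ι : Type*} [Finite ι] (hΩ : IsOpen Ω)
    {F : ι → E → ℂ} (hF : ∀ i, DifferentiableOn ℂ (F i) Ω) (hX : X = {x ∈ Ω | ∀ i, F i x = 0}) :
    IsAnalyticSubset Ω X := by
  obtain ⟨m, ⟨σ⟩⟩ := Finite.exists_equiv_fin ι
  refine ⟨fun x hx => (hX ▸ hx : x ∈ {x ∈ Ω | ∀ i, F i x = 0}).1, fun q hq =>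
    ⟨Ω, hΩ, hq, subset_rfl, m, fun i => F (σ.symm i), fun i => hF _, ?_⟩⟩
  ext x
  rw [hX]
  constructor
  · rintro ⟨⟨hx, h⟩, -⟩
    exact ⟨hx, fun i => h _⟩
  · rintro ⟨hx, h⟩
    exact ⟨⟨hx, fun i => by simpa using h (σ i)⟩, hx⟩

theorem IsAnalyticSubset.closure_inter_subset {Ω X : Set E} (hX : IsAnalyticSubset Ω X) :
    closure X ∩ Ω ⊆ X := by
  rintro q ⟨hq, hqΩ⟩
  obtain ⟨U, hU, hqU, -, m, F, hF, hXU⟩ := hX.2 q hqΩ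
  have h1 : q ∈ X ∩ U := by
    rw [hXU]
    refine ⟨hqU, fun i => ?_⟩
    have hcont : ContinuousAt (F i) q := ((hF i).differentiableAt (hU.mem_nhds hqU)).continuousAt
    have h2 : q ∈ closure (X ∩ U) := by
      rw [Set.inter_comm]
      exact hU.inter_closure ⟨hqU, hq⟩
    have h3 := mem_closure_image hcont h2
    have h4 : F i '' (X ∩ U) ⊆ {0} := by
      rw [hXU]
      rintro _ ⟨x, hx, rfl⟩
      exact hx.2 i
    exact closure_minimal h4 isClosed_singleton h3
  exact h1.1

/-- The identity theorem on a ball, reduced to one variable by restriction to the complex line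
through two points. -/
theorem eq_zero_of_eventually_eq_zero_of_mem_ball {E' : Type*} [NormedAddCommGroup E']
    [NormedSpace ℂ E'] {G : E' → ℂ} {q a b : E'} {r : ℝ}
    (hG : DifferentiableOn ℂ G (Metric.ball q r)) (ha : a ∈ Metric.ball q r)
    (hb : b ∈ Metric.ball q r) (hGa : ∀ᶠ x in 𝓝 a, G x = 0) : G b = 0 := by
  let l : ℂ → E' := fun s => a + s • (b - a)
  have hl : Differentiable ℂ l := (differentiable_id.smul_const _).const_add _
  have hl0 : l 0 = a := by simp [l]
  have hl1 : l 1 = b := by simp [l]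
  have hopen : IsOpen (l ⁻¹' Metric.ball q r) := Metric.isOpen_ball.preimage hl.continuous
  have hconv : Convex ℝ (l ⁻¹' Metric.ball q r) := by
    intro s hs t ht α β hα hβ hαβ
    have h1 : l (α • s + β • t) = α • l s + β • l t := by
      have h2 : a = α • a + β • a := by rw [← add_smul, hαβ, one_smul]
      simp only [l, add_smul, smul_add, smul_assoc]
      nth_rewrite 1 [h2]
      abel
    rw [Set.mem_preimage, h1]
    let _ : NormedSpace ℝ E' := NormedSpace.restrictScalars ℝ ℂ E'
    exact convex_ball q r hs ht hα hβ hαβ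
  have han : AnalyticOnNhd ℂ (G ∘ l) (l ⁻¹' Metric.ball q r) :=
    (hG.comp hl.differentiableOn fun s hs => hs).analyticOnNhd hopen
  have hev : G ∘ l =ᶠ[𝓝 0] 0 := by
    have h1 : Filter.Tendsto l (𝓝 0) (𝓝 a) := by
      have := hl.continuous.tendsto 0
      rwa [hl0] at this
    exact h1.eventually hGa
  have h1 := han.eqOn_zero_of_preconnected_of_eventuallyEq_zero hconv.isPreconnected
    (by rw [Set.mem_preimage, hl0]; exact ha) hev
    (show (1 : ℂ) ∈ l ⁻¹' Metric.ball q r by rw [Set.mem_preimage, hl1]; exact hb)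
  simpa [hl1] using h1

/-- If the preimage of an analytic subset under a holomorphic map contains a nonempty open part of a
connected open set, it contains all of it. -/
theorem IsAnalyticSubset.subset_preimage {E' : Type*} [NormedAddCommGroup E'] [NormedSpace ℂ E']
    {Ω X : Set E} (hX : IsAnalyticSubset Ω X) {f : E' → E} (hf : Differentiable ℂ f) {D O : Set E'}
    (hD : IsPreconnected D) (hmaps : Set.MapsTo f D Ω) (hO : IsOpen O) (hOne : (D ∩ O).Nonempty)
    (hOX : O ⊆ f ⁻¹' X) : D ⊆ f ⁻¹' X := by
  refine (hD.subset_of_closure_inter_subset isOpen_interior (hOne.mono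
    (Set.inter_subset_inter_right D (interior_maximal hOX hO))) ?_).trans interior_subset
  rintro q ⟨hq, hqD⟩
  obtain ⟨U, hU, hqU, -, m, F, hF, hXU⟩ := hX.2 (f q) (hmaps hqD)
  obtain ⟨r, hr, hball⟩ := Metric.isOpen_iff.1 (hU.preimage hf.continuous) q hqU
  obtain ⟨a, har, haI⟩ := mem_closure_iff.1 hq _ Metric.isOpen_ball (Metric.mem_ball_self hr)
  refine mem_interior.2 ⟨Metric.ball q r, fun b hb => ?_, Metric.isOpen_ball,
    Metric.mem_ball_self hr⟩
  have h1 : f b ∈ X ∩ U := by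
    rw [hXU]
    refine ⟨hball hb, fun i => ?_⟩
    refine eq_zero_of_eventually_eq_zero_of_mem_ball (G := F i ∘ f)
      ((hF i).comp hf.differentiableOn hball) har hb ?_
    filter_upwards [isOpen_interior.mem_nhds haI, Metric.isOpen_ball.mem_nhds har] with x hx hxr
    have h2 : f x ∈ X ∩ U := ⟨interior_subset (s := f ⁻¹' X) hx, hball hxr⟩
    rw [hXU] at h2
    exact h2.2 i
  exact h1.1

theorem isReduced_localRing (X : Set E) (q : E) : IsReduced (LocalRing X q) := by
  -- If a power of a germ vanishes on `X`, so does the germ.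
  refine (Ideal.isRadical_iff_quotient_reduced _).1 ?_
  rintro ⟨_, F, hF, rfl⟩ ⟨m, G, hG, hG0⟩
  refine ⟨F, rfl, ?_⟩
  have h1 : F ^ m =ᶠ[𝓝 q] G := Filter.Germ.coe_eq.1 hG
  filter_upwards [h1, hG0] with x hx hx0 hxX
  have h2 : F x ^ m = 0 := by rw [← hx0 hxX, ← hx]; rfl
  exact eq_zero_of_pow_eq_zero h2

end Analytic

section Sheet

variable {n d : ℕ} {ρ : Multiplicative (Fin n → ℤ) →* GL (Fin d) ℤ}

theorem isAnalyticSubset_sheetClosure (hρ : IsUnipotentRep ρ) (h : Fin d → ℤ) :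
    IsAnalyticSubset (bundle n d) (sheetClosure ρ h) := by
  obtain ⟨k, A, hA⟩ := exists_isAdapted hρ h
  obtain ⟨p, hp⟩ := hA.exists_invertsEmbedding hρ
  obtain ⟨e, f, -, hf⟩ := exists_binomials_definesMonomialClosure k A
  refine isAnalyticSubset_of_eq_zeroLocus (isOpen_bundle n d)
    (F := Sum.elim (equationA ρ h hA.le A p) fun b => equationB hA.le A p (f b)) ?_ ?_
  · rintro (i | b)
    · exact (differentiable_equationA hρ hA.le p i).differentiableOn
    · exact (differentiable_equationB hA.le p (f b)).differentiableOn
  · rw [hA.sheetClosure_eq hρ hp hf]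
    simp only [Sum.forall, Sum.elim_inl, Sum.elim_inr]

/-- Of two analytic subsets that cover the closure, one contains the image under the parametrization
of a nonempty open subset of the connected set `ℍⁿ`, hence the whole sheet and its closure. -/
theorem isIrreducibleAnalytic_sheetClosure (hρ : IsUnipotentRep ρ) (h : Fin d → ℤ) :
    IsIrreducibleAnalytic (bundle n d) (sheetClosure ρ h) := by
  let D : Set (Fin n → ℂ) := {z | ∀ j, 0 < (z j).im}
  have hDpi : D = Set.univ.pi fun _ => {z : ℂ | 0 < z.im} := by ext; simp [D]
  have hDconn : IsPreconnected D := by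
    rw [hDpi]
    exact (convex_pi fun _ _ => convex_halfSpace_im_gt 0).isPreconnected
  have hDopen : IsOpen D := by
    rw [hDpi]
    exact isOpen_set_pi Set.finite_univ fun _ _ =>
      isOpen_lt continuous_const Complex.continuous_im
  have hmaps : Set.MapsTo (param ρ h) D (bundle n d) := fun z hz => param_mem_bundle hz
  have hsheet : sheet ρ h ⊆ sheetClosure ρ h := by
    rintro _ ⟨z, hz, rfl⟩
    exact ⟨subset_closure ⟨z, hz, rfl⟩, param_mem_bundle hz⟩
  have hclosure : ∀ Y, IsAnalyticSubset (bundle n d) Y → sheet ρ h ⊆ Y → sheetClosure ρ h ⊆ Y :=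
    fun Y hY hs q hq => hY.closure_inter_subset ⟨closure_mono hs hq.1, hq.2⟩
  refine ⟨isAnalyticSubset_sheetClosure hρ h, ?_, fun X₁ X₂ h₁ h₂ hX => ?_⟩
  · exact ⟨_, hsheet ⟨fun _ => Complex.I, fun _ => by simp, rfl⟩⟩
  by_cases hs : sheet ρ h ⊆ X₁
  · exact Or.inl (Set.Subset.antisymm (hX ▸ Set.subset_union_left) (hclosure X₁ h₁ hs))
  refine Or.inr (Set.Subset.antisymm (hX ▸ Set.subset_union_right) (hclosure X₂ h₂ ?_))
  obtain ⟨_, ⟨z, hz, rfl⟩, hzX⟩ := Set.not_subset.1 hs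
  have hO : IsOpen (D ∩ (param ρ h ⁻¹' closure X₁)ᶜ) :=
    hDopen.inter ((isClosed_closure.preimage (differentiable_param hρ).continuous).isOpen_compl)
  have hDX := h₂.subset_preimage (differentiable_param hρ) hDconn hmaps hO
    ⟨z, hz, hz, fun hc => hzX (h₁.closure_inter_subset ⟨hc, hmaps hz⟩)⟩ (by
      rintro y ⟨hyD, hy⟩
      have h3 : param ρ h y ∈ X₁ ∪ X₂ := hX ▸ hsheet ⟨y, hyD, rfl⟩
      exact h3.resolve_left fun hc => hy (subset_closure hc))
  rintro _ ⟨y, hy, rfl⟩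
  exact hDX hy

end Sheet

end LocalSheet

end

theorem mainTheorem5 (n d : ℕ) (ρ : Multiplicative (Fin n → ℤ) →* GL (Fin d) ℤ)
    (hρ : LocalSheet.IsUnipotentRep ρ) (h : Fin d → ℤ) :
    -- coordinates adapted to `h` exist
    (∃ (k : ℕ) (A : Matrix (Fin n) (Fin n) ℤ), LocalSheet.IsAdapted ρ h k A) ∧
    -- in all such coordinates, the closure has the explicit equations
    (∀ (k : ℕ) (A : Matrix (Fin n) (Fin n) ℤ) (hA : LocalSheet.IsAdapted ρ h k A),
      (∃ p : Fin k → MvPolynomial (Fin d) ℂ, LocalSheet.InvertsEmbedding ρ h hA.le A p) ∧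
      (∃ (e : ℕ) (f : Fin e → MvPolynomial (Fin n) ℂ),
        (∀ b, LocalSheet.IsBinomial (f b)) ∧ LocalSheet.DefinesMonomialClosure k A f) ∧
      (∀ (p : Fin k → MvPolynomial (Fin d) ℂ) (e : ℕ) (f : Fin e → MvPolynomial (Fin n) ℂ),
        LocalSheet.InvertsEmbedding ρ h hA.le A p →
        LocalSheet.DefinesMonomialClosure k A f →
          (∀ i, DifferentiableOn ℂ (LocalSheet.equationA ρ h hA.le A p i)
            (LocalSheet.bundle n d)) ∧
          (∀ b, DifferentiableOn ℂ (LocalSheet.equationB hA.le A p (f b))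
            (LocalSheet.bundle n d)) ∧
          LocalSheet.sheetClosure ρ h =
            {q ∈ LocalSheet.bundle n d |
              (∀ i, LocalSheet.equationA ρ h hA.le A p i q = 0) ∧
              (∀ b, LocalSheet.equationB hA.le A p (f b) q = 0)})) ∧
    -- the closure is an analytic subset, reduced and irreducible
    LocalSheet.IsAnalyticSubset (LocalSheet.bundle n d) (LocalSheet.sheetClosure ρ h) ∧
    (∀ q ∈ LocalSheet.sheetClosure ρ h,
      IsReduced (LocalSheet.LocalRing (LocalSheet.sheetClosure ρ h) q)) ∧
    LocalSheet.IsIrreducibleAnalytic (LocalSheet.bundle n d) (LocalSheet.sheetClosure ρ h) := by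
  refine ⟨LocalSheet.exists_isAdapted hρ h, fun k A hA => ⟨hA.exists_invertsEmbedding hρ,
    LocalSheet.exists_binomials_definesMonomialClosure k A, fun p e f hp hf => ⟨fun i => ?_,
      fun b => ?_, hA.sheetClosure_eq hρ hp hf⟩⟩, LocalSheet.isAnalyticSubset_sheetClosure hρ h,
    fun q _ => LocalSheet.isReduced_localRing _ q,
    LocalSheet.isIrreducibleAnalytic_sheetClosure hρ h⟩
  · exact (LocalSheet.differentiable_equationA hρ hA.le p i).differentiableOn
  · exact (LocalSheet.differentiable_equationB hA.le p (f b)).differentiableOn
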